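/- **Theorem ($d$-Auslander correspondence).** Let $d\ge 1$ be an integer. *Conventions.* Modules are left modules, and $\mathrm{mod}\,\Lambda$ is the category of finitely generated $\Lambda$-modules. An *Artin algebra* is a ring that is an algebra over some commutative artinian ring $R$ and finitely generated as an $R$-module. For $M\in\mathrm{mod}\,\Lambda$, $\mathrm{add}(M)$ is the full subcategory of modules isomorphic to direct summands of finite direct sums of copies of $M$, and $\mathrm{End}_\Lambda(M)$ is the endomorphism ring, with $fg$ meaning "first $f$, then $g$". A subcategory $\mathcal C\subseteq\mathrm{mod}\,\Lambda$ is *$d$-cluster-tilting* if it is functorially finite in $\mathrm{mod}\,\Lambda$ (every module in $\mathrm{mod}\,\Lambda$ has a right and a left $\mathcal C$-approximation) and $$\mathcal C=\{X\in\mathrm{mod}\,\Lambda\mid \mathrm{Ext}^i_\Lambda(C,X)=0\ \ \forall\, 0<i<d,\ C\in\mathcal C\}=\{X\in\mathrm{mod}\,\Lambda\mid \mathrm{Ext}^i_\Lambda(X,C)=0\ \ \forall\, 0<i<d,\ C\in\mathcal C\}.$$ A module $M$ is *$d$-cluster-tilting* if $\mathrm{add}(M)$ is. Two $d$-cluster-tilting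 modules $M\in\mathrm{mod}\,\Lambda$ and $N\in\mathrm{mod}\,\Lambda'$, over possibly different Artin algebras, are *equivalent* if the categories $\mathrm{add}(M)$ and $\mathrm{add}(N)$ are equivalent. The *dominant dimension* $\mathrm{dom.dim}\,\Gamma\in\mathbb N\cup\{\infty\}$ is the largest $n$ such that, in a minimal injective resolution $0\to\Gamma\to I_0\to I_1\to\cdots$ of the left module $\Gamma$, the modules $I_0,\dots,I_{n-1}$ are projective ($\infty$ if all $I_j$ are projective). The *global dimension* $\mathrm{gl.dim}\,\Gamma$ is the supremum of the projective dimensions of the modules in $\mathrm{mod}\,\Gamma$. A *$d$-Auslander algebra* is an Artin algebra $\Gamma$ with $\mathrm{dom.dim}\,\Gamma\ge d+1\ge\mathrm{gl.dim}\,\Gamma$. *Statement.* 1. If $X$ is a $d$-cluster-tilting module over an Artin algebra $\Lambda$, then $\mathrm{End}_\Lambda(X)$ is a $d$-Auslander algebra, and $X\mapsto\mathrm{End}_\Lambda(X)$ induces a well-defined bijection from the equivalence classes of $d$-cluster-tilting modules $X$ over Artin algebras $\Lambda$ to the Morita-equivalence classes of $d$-Auslander algebras. 2. The same holds over any fixed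 commutative artinian ring $R$ (for instance a field) with all linear structures taken over $R$: $\Lambda$ and $\Gamma$ range over the $R$-algebras that are finitely generated as $R$-modules, and equivalences of the categories $\mathrm{add}(X)$ and Morita equivalences are $R$-linear. -/

import Mathlib

open CategoryTheory
open scoped ModuleCat.Algebra

universe v u

namespace AuslanderCorr

section Homological

variable {Λ : Type u} [Ring Λ]

/-- `add M`: the modules isomorphic to a direct summand of a finite direct sum of copies
of `M`. -/
def addClosure (M : ModuleCat.{u} Λ) : ObjectProperty (ModuleCat.{u} Λ) :=
  fun N => ∃ n : ℕ, Nonempty (Retract N (ModuleCat.of Λ (Fin n → M)))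

/-- Every finitely generated module has a right `C`-approximation. -/
def IsContravariantlyFinite (C : ObjectProperty (ModuleCat.{u} Λ)) : Prop :=
  ∀ M : ModuleCat.{u} Λ, Module.Finite Λ M →
    ∃ (C₀ : ModuleCat.{u} Λ) (f : C₀ ⟶ M), C C₀ ∧
      ∀ (X : ModuleCat.{u} Λ), C X → ∀ g : X ⟶ M, ∃ h : X ⟶ C₀, h ≫ f = g

/-- Every finitely generated module has a left `C`-approximation. -/
def IsCovariantlyFinite (C : ObjectProperty (ModuleCat.{u} Λ)) : Prop :=
  ∀ M : ModuleCat.{u} Λ, Module.Finite Λ M →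
    ∃ (C₀ : ModuleCat.{u} Λ) (f : M ⟶ C₀), C C₀ ∧
      ∀ (X : ModuleCat.{u} Λ), C X → ∀ g : M ⟶ X, ∃ h : C₀ ⟶ X, f ≫ h = g

/-- `C` is a `d`-cluster-tilting subcategory of the category `mod Λ` of finitely generated
left `Λ`-modules. -/
structure IsClusterTiltingSubcategory (d : ℕ) (C : ObjectProperty (ModuleCat.{u} Λ)) :
    Prop where
  fg : ∀ X, C X → Module.Finite Λ X
  contravariantlyFinite : IsContravariantlyFinite C
  covariantlyFinite : IsCovariantlyFinite C
  mem_iff_right : ∀ X : ModuleCat.{u} Λ, C X ↔ Module.Finite Λ X ∧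
    ∀ (i : ℕ), 0 < i → i < d → ∀ Y, C Y → Subsingleton (Abelian.Ext Y X i)
  mem_iff_left : ∀ X : ModuleCat.{u} Λ, C X ↔ Module.Finite Λ X ∧
    ∀ (i : ℕ), 0 < i → i < d → ∀ Y, C Y → Subsingleton (Abelian.Ext X Y i)

/-- `M` is a `d`-cluster-tilting module. -/
def IsClusterTilting (d : ℕ) (M : ModuleCat.{u} Λ) : Prop :=
  IsClusterTiltingSubcategory d (addClosure M)

/-- A submodule is essential if it meets every nonzero submodule nontrivially. -/
def IsEssential {M : Type u} [AddCommGroup M] [Module Λ M] (N : Submodule Λ M) : Prop :=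
  ∀ L : Submodule Λ M, N ⊓ L = ⊥ → L = ⊥

/-- A minimal injective resolution `0 → M → I 0 → I 1 → ⋯`: an exact sequence with injective
terms in which the image of each map is essential in the next term. -/
structure MinimalInjectiveResolution (M : ModuleCat.{u} Λ) where
  I : ℕ → ModuleCat.{u} Λ
  ι : M →ₗ[Λ] I 0
  δ : ∀ n, I n →ₗ[Λ] I (n + 1)
  injective : ∀ n, Module.Injective Λ (I n)
  ι_injective : Function.Injective ι
  exact_zero : Function.Exact ι (δ 0)
  exact_succ : ∀ n, Function.Exact (δ n) (δ (n + 1))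
  essential_zero : IsEssential (LinearMap.range ι)
  essential_succ : ∀ n, IsEssential (LinearMap.range (δ n))

variable (Λ) in
/-- The dominant dimension of `Λ`: the largest `n` (possibly `∞`) such that the first `n` terms
of a minimal injective resolution of the left module `Λ` are projective. -/
noncomputable def dominantDimension : ℕ∞ :=
  ⨆ n ∈ {n : ℕ | ∃ J : MinimalInjectiveResolution (ModuleCat.of Λ Λ),
    ∀ i < n, Module.Projective Λ (J.I i)}, (n : ℕ∞)

variable (Λ) in
/-- The global dimension of `Λ`: the supremum of the projective dimensions of the finitely
generated left `Λ`-modules. -/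
noncomputable def globalDimension : WithBot ℕ∞ :=
  ⨆ M ∈ {M : ModuleCat.{u} Λ | Module.Finite Λ M}, projectiveDimension M

variable (Λ) in
/-- `dom.dim Λ ≥ d + 1 ≥ gl.dim Λ`. -/
def IsAuslander (d : ℕ) : Prop :=
  ((d + 1 : ℕ) : ℕ∞) ≤ dominantDimension Λ ∧
    globalDimension Λ ≤ ((d + 1 : ℕ) : WithBot ℕ∞)

end Homological

/-- A ring is an Artin algebra if it is a finitely generated module over some commutative
artinian ring over which it is an algebra. -/
def IsArtinAlgebra (Λ : Type u) [Ring Λ] : Prop :=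
  ∃ (R : Type u) (_ : CommRing R) (_ : Algebra R Λ), IsArtinianRing R ∧ Module.Finite R Λ

/-- The class of all Artin algebras (regarded as `ℤ`-algebras, that is, as rings). -/
def artinAlgebras : ObjectProperty (AlgCat.{u} ℤ) :=
  fun Λ => IsArtinAlgebra Λ

/-- The class of all `R`-algebras that are finitely generated as `R`-modules. -/
def finiteAlgebras (R : Type v) [CommRing R] : ObjectProperty (AlgCat.{u} R) :=
  fun Λ => Module.Finite R Λ

section Classes

variable {k : Type v} [CommRing k]

/-- A `d`-cluster-tilting module over some algebra in the class `A` of `k`-algebras. -/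
structure ClusterTiltingModule (A : ObjectProperty (AlgCat.{u} k)) (d : ℕ) where
  alg : AlgCat.{u} k
  mem : A alg
  module : ModuleCat.{u} alg
  isClusterTilting : IsClusterTilting d module

/-- The category `add M`. -/
abbrev ClusterTiltingModule.AddCat {A : ObjectProperty (AlgCat.{u} k)} {d : ℕ}
    (X : ClusterTiltingModule A d) : Type (u + 1) :=
  (addClosure X.module).FullSubcategory

/-- The endomorphism algebra of `M`. Composition is written from left to right (`f * g` is
`f` followed by `g`), hence the opposite of `Module.End`. -/
abbrev ClusterTiltingModule.endAlg {A : ObjectProperty (AlgCat.{u} k)} {d : ℕ}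
    (X : ClusterTiltingModule A d) : AlgCat.{u} k :=
  AlgCat.of k (Module.End X.alg X.module)ᵐᵒᵖ

/-- An algebra in the class `A` of `k`-algebras which is `d`-Auslander. -/
structure AuslanderAlgebra (A : ObjectProperty (AlgCat.{u} k)) (d : ℕ) where
  alg : AlgCat.{u} k
  mem : A alg
  isAuslander : IsAuslander alg d

/-- Cluster-tilting modules `M` and `N` (possibly over different algebras) are equivalent if the
categories `add M` and `add N` are equivalent, as `k`-linear categories. -/
def clusterTiltingSetoid (A : ObjectProperty (AlgCat.{u} k)) (d : ℕ) :
    Setoid (ClusterTiltingModule A d) where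
  r X Y := ∃ e : X.AddCat ≌ Y.AddCat, e.functor.Linear k
  iseqv :=
    { refl := fun _ => ⟨CategoryTheory.Equivalence.refl, Functor.instLinearId⟩
      symm := fun ⟨e, _⟩ => ⟨e.symm, e.inverseLinear k⟩
      trans := fun ⟨e, _⟩ ⟨e', _⟩ => ⟨e.trans e', e.functor.instLinearComp e'.functor⟩ }

/-- Morita equivalence over `k`. -/
def moritaSetoid (A : ObjectProperty (AlgCat.{u} k)) (d : ℕ) :
    Setoid (AuslanderAlgebra A d) where
  r Γ Γ' := IsMoritaEquivalent k Γ.alg Γ'.alg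
  iseqv :=
    { refl := fun _ => IsMoritaEquivalent.refl k _
      symm := fun h => h.symm
      trans := fun h h' => h.trans k h' }

end Classes

end AuslanderCorr

/-!
# The higher Auslander correspondence

The proof rests on the functors `Hom(U, -)` from `A`-modules to modules over `EndOp A U`, the
opposite of the endomorphism ring of a finitely generated module `U`. The basic observation
(`evalSum_comp_eq_zero`) is that an `EndOp A U`-linear map defined on a submodule of `Hom(U, M)`
preserves all relations that `U` can see. Hence if `I` is injective and a map into `I` vanishing
on all images of `U` is zero (`Separates`), then `Hom(U, I)` is injective and `Hom(U, -)` is fully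
faithful on maps into `I`, and also on maps into kernels of maps between such modules
(`injective_hom`, `exists_homMap_eq_of_copresentation`).

**From cluster tilting modules to Auslander algebras.** Let `X` be `d`-cluster tilting over `Λ`.
It has the ring and the finitely generated injective modules in its additive closure, so
`Hom(X, I)` is projective-injective for `I` finitely generated injective. Since `Ext^i(X, X) = 0`
for `0 < i < d`, an injective resolution of `X` yields `d + 1` projective-injective terms of a
coresolution of `EndOp Λ X` (`hasCoresolution_hom`); that the minimal resolution then also starts with
projective terms is `HasCoresolution.of_isEssential`. A second syzygy over `EndOp Λ X` has the
form `Hom(X, K)`, and resolving `K` by `add X`-approximations ends after `d - 1` steps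
(`pdLT_hom`), which bounds the global dimension.

**From Auslander algebras to cluster tilting modules.** Let `Γ` be `d`-Auslander and `Q` the sum
of the first `d + 1` terms of its minimal injective resolution. There is a finitely generated
projective module `P` which maps trivially to all modules `Z` with `Hom(Z, Q) = 0` and
nontrivially to all nonzero submodules of `Q` (`exists_projective_torsion`). Then `Hom(P, Q)` is
an injective cogenerator over `EndOp Γ P`, so every finitely generated module over `EndOp Γ P` is
`Hom(P, Y)` for a `Γ`-module `Y` with a copresentation in `add Q`; vanishing of `m` groups
`Ext^i(Hom(P, Γ), Hom(P, Y))` lowers the projective dimension of `Y` to less than `d - m`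
(`IsDetecting.exists_equiv_hom`). Hence `Hom(P, Γ)` is `d`-cluster tilting
(`IsDetecting.isClusterTiltingModule`), and its endomorphism algebra is `Γ` by full faithfulness.

**Equivalences.** The functor `Hom(U, -)` identifies `add U` with the finitely generated
projective modules over `EndOp A U`. A Morita equivalence preserves these, and conversely an
equivalence `add U ≌ add V` exhibits `EndOp A U` as the endomorphism algebra of a progenerator
over `EndOp B V` (`isMoritaEquivalent_of_equivalence`,
`exists_equivalence_of_isMoritaEquivalent`).

All of this is compatible with the action of a base ring `k`, so `exists_correspondence` covers
all Artin algebras (`k = ℤ`) and the finite algebras over an artinian ring simultaneously.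
-/

namespace AuslanderCorr

/-! ### Vanishing of `Ext` and projective dimension for unbundled modules -/

section ExtVanishing

variable {A : Type u} [Ring A]
variable {X K Y N U : Type u} [AddCommGroup X] [Module A X] [AddCommGroup K] [Module A K]
  [AddCommGroup Y] [Module A Y] [AddCommGroup N] [Module A N] [AddCommGroup U] [Module A U]

variable (A X Y) in
/-- `Ext^i_A(X, Y) = 0`, for unbundled modules. -/
def ExtVanishes (i : ℕ) : Prop :=
  Subsingleton (Abelian.Ext (ModuleCat.of A X) (ModuleCat.of A Y) i)

variable (A X) in
/-- The projective dimension of `X` is less than `n`, for unbundled modules. -/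
def PdLT (n : ℕ) : Prop := HasProjectiveDimensionLT (ModuleCat.of A X) n

lemma shortExact_of {f : K →ₗ[A] Y} {g : Y →ₗ[A] N} (hf : Function.Injective f)
    (hg : Function.Surjective g) (h : Function.Exact f g) :
    (ModuleCat.shortComplexOfCompEqZero f g h.linearMap_comp_eq_zero).ShortExact :=
  ModuleCat.shortComplex_shortExact _ h hf hg

section

variable {f : K →ₗ[A] Y} {g : Y →ₗ[A] N} (hf : Function.Injective f)
    (hg : Function.Surjective g) (h : Function.Exact f g)
include hf hg h

lemma ExtVanishes.left_of_shortExact {i : ℕ} (h₁ : ExtVanishes A X N i)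
    (h₂ : ExtVanishes A X Y (i + 1)) : ExtVanishes A X K (i + 1) := by
  refine ⟨fun a b => ?_⟩
  have key : ∀ a : Abelian.Ext (ModuleCat.of A X) (ModuleCat.of A K) (i + 1), a = 0 := by
    intro a
    obtain ⟨x, rfl⟩ := Abelian.Ext.covariant_sequence_exact₁ _ (shortExact_of hf hg h) a
      (h₂.elim _ _) rfl
    rw [show x = 0 from h₁.elim _ _, Abelian.Ext.zero_comp]
  rw [key a, key b]

lemma ExtVanishes.right_of_shortExact {i : ℕ} (h₁ : ExtVanishes A X Y i)
    (h₂ : ExtVanishes A X K (i + 1)) : ExtVanishes A X N i := by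
  refine ⟨fun a b => ?_⟩
  have key : ∀ a : Abelian.Ext (ModuleCat.of A X) (ModuleCat.of A N) i, a = 0 := by
    intro a
    obtain ⟨x, rfl⟩ := Abelian.Ext.covariant_sequence_exact₃ _ (shortExact_of hf hg h) a
      rfl (h₂.elim _ _)
    rw [show x = 0 from h₁.elim _ _, Abelian.Ext.zero_comp]
  rw [key a, key b]

/-- Maps into a quotient lift when `Ext¹` into the kernel vanishes. -/
lemma ExtVanishes.exists_lift (h₁ : ExtVanishes A X K 1) (φ : X →ₗ[A] N) :
    ∃ ψ : X →ₗ[A] Y, g ∘ₗ ψ = φ := by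
  obtain ⟨x, hx⟩ := Abelian.Ext.covariant_sequence_exact₃ _ (shortExact_of hf hg h)
    (Abelian.Ext.mk₀ (ModuleCat.ofHom φ)) rfl (h₁.elim _ _)
  obtain ⟨ψ, rfl⟩ := Abelian.Ext.homEquiv₀.symm.surjective x
  refine ⟨ψ.hom, ?_⟩
  have := Abelian.Ext.homEquiv₀.symm.injective
    (a₁ := ψ ≫ ModuleCat.ofHom g) (a₂ := ModuleCat.ofHom φ) (by simpa using hx)
  exact congrArg ModuleCat.Hom.hom this

lemma extVanishes_one_of_lift (h₁ : ExtVanishes A X Y 1)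
    (hl : ∀ φ : X →ₗ[A] N, ∃ ψ : X →ₗ[A] Y, g ∘ₗ ψ = φ) : ExtVanishes A X K 1 := by
  refine ⟨fun a b => ?_⟩
  have key : ∀ a : Abelian.Ext (ModuleCat.of A X) (ModuleCat.of A K) 1, a = 0 := by
    intro a
    have hS := shortExact_of hf hg h
    obtain ⟨x, rfl⟩ := Abelian.Ext.covariant_sequence_exact₁ _ hS a
      (h₁.elim _ _) rfl
    obtain ⟨φ, rfl⟩ := Abelian.Ext.homEquiv₀.symm.surjective x
    obtain ⟨ψ, hψ⟩ := hl φ.hom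
    have e : φ = ModuleCat.ofHom ψ ≫ ModuleCat.ofHom g := by
      ext x; exact (congrArg (fun l => l x) hψ).symm
    rw [e, Abelian.Ext.homEquiv₀_symm_apply, ← Abelian.Ext.mk₀_comp_mk₀,
      Abelian.Ext.comp_assoc_of_second_deg_zero]
    erw [hS.comp_extClass]
    rw [Abelian.Ext.comp_zero]
  rw [key a, key b]

lemma PdLT.right_of_shortExact {n : ℕ} (h₁ : PdLT A K n) (h₂ : PdLT A Y (n + 1)) :
    PdLT A N (n + 1) :=
  (shortExact_of hf hg h).hasProjectiveDimensionLT_X₃ n h₁ h₂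

lemma PdLT.left_of_shortExact {n : ℕ} (h₁ : PdLT A Y n) (h₂ : PdLT A N (n + 1)) :
    PdLT A K n :=
  (shortExact_of hf hg h).hasProjectiveDimensionLT_X₁ n h₁ h₂

end

lemma extVanishes_of_injective [Module.Injective A Y] (i : ℕ) (hi : 0 < i) :
    ExtVanishes A X Y i := by
  have : Injective (ModuleCat.of A Y) := Module.injective_object_of_injective_module A Y
  obtain ⟨i, rfl⟩ := Nat.exists_eq_succ_of_ne_zero hi.ne'
  exact Abelian.Ext.subsingleton_of_injective _ _ _

lemma extVanishes_of_projective [Module.Projective A X] (i : ℕ) (hi : 0 < i) :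
    ExtVanishes A X Y i := by
  obtain ⟨i, rfl⟩ := Nat.exists_eq_succ_of_ne_zero hi.ne'
  exact Abelian.Ext.subsingleton_of_projective _ _ _

lemma pdLT_one_iff : PdLT A X 1 ↔ Module.Projective A X := by
  rw [PdLT, ← projective_iff_hasProjectiveDimensionLT_one, ← IsProjective.iff_projective]

lemma PdLT.mono {m n : ℕ} (h : PdLT A X m) (hmn : m ≤ n) : PdLT A X n :=
  have : HasProjectiveDimensionLT (ModuleCat.of A X) m := h
  hasProjectiveDimensionLT_of_ge _ m n hmn

lemma pdLT_succ_of_projective [Module.Projective A X] (n : ℕ) : PdLT A X (n + 1) :=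
  (pdLT_one_iff.2 inferInstance).mono (by omega)

end ExtVanishing

/-! ### The additive closure of a module -/

section AddClosure

variable {A : Type u} [Ring A]
variable {X Y N U : Type u} [AddCommGroup X] [Module A X]
  [AddCommGroup Y] [Module A Y] [AddCommGroup N] [Module A N] [AddCommGroup U] [Module A U]

/-- `N ∈ add U`, for unbundled modules: `N` is a retract of some `Uⁿ`. -/
def IsInAdd (A : Type u) [Ring A] (U N : Type u) [AddCommGroup U] [Module A U] [AddCommGroup N]
    [Module A N] : Prop :=
  ∃ (n : ℕ) (t : N →ₗ[A] (Fin n → U)) (s : (Fin n → U) →ₗ[A] N), s ∘ₗ t = LinearMap.id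

lemma addClosure_iff (M N : ModuleCat.{u} A) : addClosure M N ↔ IsInAdd A M N := by
  constructor
  · rintro ⟨n, ⟨r⟩⟩
    exact ⟨n, r.i.hom, r.r.hom, congrArg ModuleCat.Hom.hom r.retract⟩
  · rintro ⟨n, t, s, h⟩
    exact ⟨n, ⟨ModuleCat.ofHom t, ModuleCat.ofHom s, by ext x; exact congrArg (fun l => l x) h⟩⟩

lemma IsInAdd.exists_sum (h : IsInAdd A U N) : ∃ (n : ℕ) (t : Fin n → (N →ₗ[A] U))
    (s : Fin n → (U →ₗ[A] N)), ∑ i, s i ∘ₗ t i = LinearMap.id := by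
  obtain ⟨n, t, s, h⟩ := h
  refine ⟨n, fun i => LinearMap.proj i ∘ₗ t, fun i => s ∘ₗ LinearMap.single A (fun _ => U) i, ?_⟩
  rw [← h]
  ext x
  simp only [LinearMap.sum_apply, LinearMap.comp_apply, LinearMap.proj_apply, ← map_sum]
  congr 1
  exact LinearMap.sum_single_apply (v := t x)

lemma IsInAdd.of_sum {ι : Type*} [Fintype ι] (t : ι → (N →ₗ[A] U))
    (s : ι → (U →ₗ[A] N)) (h : ∑ i, s i ∘ₗ t i = LinearMap.id) : IsInAdd A U N := by
  let e := Fintype.equivFin ι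
  refine ⟨Fintype.card ι, LinearMap.pi fun i => t (e.symm i),
    ∑ i, s (e.symm i) ∘ₗ LinearMap.proj i, ?_⟩
  rw [← h]
  ext x
  simp only [LinearMap.comp_apply, LinearMap.sum_apply, LinearMap.proj_apply, LinearMap.pi_apply]
  exact e.symm.sum_comp (fun i => s i (t i x))

lemma isInAdd_self : IsInAdd A U U :=
  .of_sum (ι := Unit) (fun _ => LinearMap.id) (fun _ => LinearMap.id) (by simp)

lemma IsInAdd.retract (h : IsInAdd A U N) (t : Y →ₗ[A] N) (s : N →ₗ[A] Y)
    (hst : s ∘ₗ t = LinearMap.id) : IsInAdd A U Y := by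
  obtain ⟨n, t', s', h⟩ := h
  refine ⟨n, t' ∘ₗ t, s ∘ₗ s', ?_⟩
  rw [LinearMap.comp_assoc, ← LinearMap.comp_assoc t, h, LinearMap.id_comp, hst]

lemma IsInAdd.of_linearEquiv (h : IsInAdd A U N) (e : N ≃ₗ[A] Y) : IsInAdd A U Y :=
  h.retract e.symm e (by ext; simp)

lemma IsInAdd.pi {ι : Type*} [Finite ι] {N : ι → Type u} [∀ i, AddCommGroup (N i)]
    [∀ i, Module A (N i)] {M : Type u} [AddCommGroup M] [Module A M]
    (e : M ≃ₗ[A] ∀ i, N i)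
    (h : ∀ i, IsInAdd A U (N i)) : IsInAdd A U M := by
  classical
  have := Fintype.ofFinite ι
  choose n t s hst using fun i => (h i).exists_sum
  refine .of_sum (ι := Σ i, Fin (n i)) (fun p => t p.1 p.2 ∘ₗ LinearMap.proj p.1 ∘ₗ e.toLinearMap)
    (fun p => e.symm.toLinearMap ∘ₗ LinearMap.single A _ p.1 ∘ₗ s p.1 p.2) ?_
  ext x
  rw [LinearMap.sum_apply, Fintype.sum_sigma]
  simp only [LinearMap.comp_apply, LinearMap.proj_apply, ← map_sum]
  simp only [LinearEquiv.coe_coe, LinearMap.id_apply]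
  have : ∀ i, ∑ j, (s i j) ((t i j) (e x i)) = e x i := fun i => by
    simpa using congrArg (fun l => l (e x i)) (hst i)
  rw [LinearEquiv.symm_apply_eq]
  refine Eq.trans (Finset.sum_congr rfl fun i _ => ?_) (LinearMap.sum_single_apply (v := e x))
  exact (map_sum (LinearMap.single A N i) _ _).symm.trans (by rw [this i]; rfl)

lemma IsInAdd.trans (h : IsInAdd A N Y) (h' : IsInAdd A U N) : IsInAdd A U Y := by
  obtain ⟨n, t, s, hst⟩ := h
  exact IsInAdd.retract (.pi (LinearEquiv.refl A (Fin n → N)) fun _ => h') t s hst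

lemma IsInAdd.finite (h : IsInAdd A U N) [Module.Finite A U] : Module.Finite A N := by
  obtain ⟨n, t, s, hst⟩ := h
  exact Module.Finite.of_surjective s fun x => ⟨t x, congrArg (fun l => l x) hst⟩

lemma IsInAdd.projective (h : IsInAdd A U N) [Module.Projective A U] : Module.Projective A N := by
  obtain ⟨n, t, s, hst⟩ := h
  have : Module.Projective A (Fin n → U) :=
    Module.Projective.of_equiv DFinsupp.linearEquivFunOnFintype
  exact Module.Projective.of_split t s hst

lemma IsInAdd.injective (h : IsInAdd A U N) [Module.Injective A U] : Module.Injective A N := by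
  obtain ⟨n, t, s, hst⟩ := h
  refine ⟨fun X Y _ _ _ _ f hf g => ?_⟩
  obtain ⟨k, hk⟩ := Module.Injective.extension_property A (Fin n → U) X Y f hf (t ∘ₗ g)
  refine ⟨s ∘ₗ k, fun x => ?_⟩
  have h1 := congrArg (fun l => s (l x)) hk
  have h2 := congrArg (fun l => l (g x)) hst
  exact h1.trans h2

lemma IsInAdd.of_projective [Module.Finite A N] [Module.Projective A N] : IsInAdd A A N := by
  obtain ⟨n, s, hs⟩ := Module.Finite.exists_fin' A N
  obtain ⟨t, ht⟩ := Module.projective_lifting_property s LinearMap.id hs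
  exact ⟨n, t, s, ht⟩

lemma IsInAdd.extVanishes_right {i : ℕ} (h : IsInAdd A U N) (hX : ExtVanishes A X U i) :
    ExtVanishes A X N i := by
  obtain ⟨n, t, s, hst⟩ := h.exists_sum
  refine ⟨fun a b => ?_⟩
  have key : ∀ a : Abelian.Ext (ModuleCat.of A X) (ModuleCat.of A N) i, a = 0 := by
    intro a
    have e : 𝟙 (ModuleCat.of A N) = ∑ j, ModuleCat.ofHom (t j) ≫ ModuleCat.ofHom (s j) := by
      apply ModuleCat.hom_ext
      rw [ModuleCat.hom_sum]
      exact hst.symm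
    rw [← Abelian.Ext.comp_mk₀_id a, e, Abelian.Ext.mk₀_sum, Abelian.Ext.comp_sum]
    refine Finset.sum_eq_zero fun j _ => ?_
    rw [← Abelian.Ext.mk₀_comp_mk₀, ← Abelian.Ext.comp_assoc_of_third_deg_zero,
      show a.comp (Abelian.Ext.mk₀ (ModuleCat.ofHom (t j))) (add_zero i) = 0 from hX.elim _ _,
      Abelian.Ext.zero_comp]
  rw [key a, key b]

lemma IsInAdd.extVanishes_left {i : ℕ} (h : IsInAdd A U N) (hX : ExtVanishes A U X i) :
    ExtVanishes A N X i := by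
  obtain ⟨n, t, s, hst⟩ := h.exists_sum
  refine ⟨fun a b => ?_⟩
  have key : ∀ a : Abelian.Ext (ModuleCat.of A N) (ModuleCat.of A X) i, a = 0 := by
    intro a
    have e : 𝟙 (ModuleCat.of A N) = ∑ j, ModuleCat.ofHom (t j) ≫ ModuleCat.ofHom (s j) := by
      apply ModuleCat.hom_ext
      rw [ModuleCat.hom_sum]
      exact hst.symm
    rw [← Abelian.Ext.mk₀_id_comp a, e, Abelian.Ext.mk₀_sum, Abelian.Ext.sum_comp]
    refine Finset.sum_eq_zero fun j _ => ?_
    rw [← Abelian.Ext.mk₀_comp_mk₀, Abelian.Ext.comp_assoc_of_second_deg_zero,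
      show (Abelian.Ext.mk₀ (ModuleCat.ofHom (s j))).comp a (zero_add i) = 0 from hX.elim _ _,
      Abelian.Ext.comp_zero]
  rw [key a, key b]

end AddClosure

/-! ### Injective hulls -/

section InjectiveHull

variable {A : Type u} [Ring A]
variable {M E Y : Type u} [AddCommGroup M] [Module A M] [AddCommGroup E] [Module A E]
  [AddCommGroup Y] [Module A Y]

lemma IsEssential.injective_of_comp {ι : M →ₗ[A] E} (h : IsEssential (LinearMap.range ι))
    (k : E →ₗ[A] Y) (hk : Function.Injective (k ∘ₗ ι)) : Function.Injective k := by
  rw [← LinearMap.ker_eq_bot]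
  refine h _ ?_
  rw [eq_bot_iff]
  rintro _ ⟨⟨m, rfl⟩, hm⟩
  have : m = 0 := hk (by simpa using hm)
  simp [this]

lemma exists_injective_embedding (A : Type u) [Ring A] (M : Type u) [AddCommGroup M] [Module A M] :
    ∃ (Q : ModuleCat.{u} A) (f : M →ₗ[A] Q), Module.Injective A Q ∧ Function.Injective f := by
  refine ⟨Injective.under (ModuleCat.of A M), (Injective.ι (ModuleCat.of A M)).hom, ?_, ?_⟩
  · exact Module.injective_module_of_injective_object (inj := inferInstanceAs
      (Injective (Injective.under (ModuleCat.of A M))))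
  · exact (ModuleCat.mono_iff_injective _).1 inferInstance

/-- Every module has an injective hull: inside an injective module `Q` containing `M`, a maximal
essential extension of `M` is a direct summand of `Q`. -/
lemma exists_injective_hull (A : Type u) [Ring A] (M : Type u) [AddCommGroup M] [Module A M] :
    ∃ (E : ModuleCat.{u} A) (f : M →ₗ[A] E), Module.Injective A E ∧ Function.Injective f ∧
      IsEssential (LinearMap.range f) := by
  obtain ⟨Q, f, hQ, hf⟩ := exists_injective_embedding A M
  set N := LinearMap.range f with hN
  let S : Set (Submodule A Q) := {E | N ≤ E ∧ ∀ L ≤ E, N ⊓ L = ⊥ → L = ⊥}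
  obtain ⟨E, hNE, hE⟩ := zorn_le_nonempty₀ S (by
    intro c hc hchain E₀ hE₀
    refine ⟨sSup c, ⟨(hc hE₀).1.trans (le_sSup hE₀), fun L hL hNL => ?_⟩, fun _ => le_sSup⟩
    rw [eq_bot_iff]
    intro x hx
    obtain ⟨E, hEc, hxE⟩ := (Submodule.mem_sSup_of_directed ⟨E₀, hE₀⟩ hchain.directedOn).1 (hL hx)
    have := (hc hEc).2 (Submodule.span A {x})
      ((Submodule.span_singleton_le_iff_mem _ _).2 hxE)
      (le_bot_iff.1 ((inf_le_inf_left N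
        ((Submodule.span_singleton_le_iff_mem _ _).2 hx)).trans hNL.le))
    simpa using this) N ⟨le_rfl, fun L hL h => by rwa [inf_eq_right.2 hL] at h⟩
  have hES := hE.prop
  obtain ⟨C, -, hC⟩ := zorn_le_nonempty₀ {C : Submodule A Q | Disjoint E C} (by
    intro c hc hchain C₀ hC₀
    exact ⟨sSup c, (hchain.directedOn.disjoint_sSup_right).2 fun b hb => hc hb,
      fun _ => le_sSup⟩) ⊥ disjoint_bot_right
  -- modulo a maximal complement `C`, the module `E` becomes essential, so `g` below is injective
  -- with image in `E` by maximality of `E`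
  have hEC : Disjoint E C := hC.prop
  let π : E →ₗ[A] Q ⧸ C := C.mkQ ∘ₗ E.subtype
  have hπ : Function.Injective π := by
    rw [injective_iff_map_eq_zero]
    intro x hx
    have hxC : (x : Q) ∈ C := (Submodule.Quotient.mk_eq_zero C).1 hx
    exact Subtype.ext (Submodule.disjoint_def.1 hEC x x.2 hxC)
  obtain ⟨g, hg⟩ := Module.Injective.extension_property A Q E (Q ⧸ C) π hπ E.subtype
  have hg' : ∀ x : E, g (C.mkQ x) = x := fun x => congrArg (fun l => l x) hg
  have hess : IsEssential (LinearMap.range π) := by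
    intro L hL
    have h1 : C ≤ L.comap C.mkQ := by
      intro x hx
      simp [(Submodule.Quotient.mk_eq_zero C).2 hx]
    have h2 : L.comap C.mkQ ≤ C := hC.le_of_ge (by
      refine Submodule.disjoint_def.2 fun x hxE hxL => ?_
      have : C.mkQ x ∈ LinearMap.range π ⊓ L := ⟨⟨⟨x, hxE⟩, rfl⟩, hxL⟩
      rw [hL] at this
      exact Submodule.disjoint_def.1 hEC x hxE ((Submodule.Quotient.mk_eq_zero C).1 this)) h1
    rw [eq_bot_iff]
    intro y hy
    obtain ⟨x, rfl⟩ := C.mkQ_surjective y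
    exact (Submodule.Quotient.mk_eq_zero C).2 (h2 hy)
  have hginj : Function.Injective g :=
    hess.injective_of_comp g (by rw [hg]; exact E.injective_subtype)
  have hrange : LinearMap.range g ≤ E := hE.le_of_ge (by
    refine ⟨fun x hx => ⟨C.mkQ x, hg' ⟨x, hNE hx⟩⟩, fun L hL hNL => ?_⟩
    have h1 : L ⊓ E = ⊥ := hES.2 _ inf_le_right
      (le_bot_iff.1 ((inf_le_inf_left N inf_le_left).trans hNL.le))
    have h2 : L.comap g = ⊥ := hess _ (by
      rw [eq_bot_iff]
      rintro _ ⟨⟨x, rfl⟩, hx⟩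
      have hx' : g (C.mkQ x) ∈ L := hx
      rw [hg'] at hx'
      have : (x : Q) ∈ L ⊓ E := ⟨hx', x.2⟩
      rw [h1] at this
      have : x = 0 := Subtype.ext this
      simp [this])
    rw [← Submodule.map_comap_eq_of_le hL, h2, Submodule.map_bot]) (fun x hx =>
      ⟨C.mkQ x, hg' ⟨x, hx⟩⟩)
  refine ⟨ModuleCat.of A E, f.codRestrict E fun m => hNE ⟨m, rfl⟩, ?_, ?_, ?_⟩
  · let p : Q →ₗ[A] E := (g ∘ₗ C.mkQ).codRestrict E fun x => hrange ⟨_, rfl⟩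
    exact (isInAdd_self.retract E.subtype p (by ext x; exact hg' x)).injective
  · intro a b hab
    exact hf (congrArg Subtype.val hab)
  · intro L hL
    have := hES.2 (L.map E.subtype) (Submodule.map_subtype_le E L) (by
      rw [eq_bot_iff]
      rintro _ ⟨⟨m, rfl⟩, ⟨x, hxL, hx⟩⟩
      have : x ∈ LinearMap.range (f.codRestrict E fun m => hNE ⟨m, rfl⟩) ⊓ L :=
        ⟨⟨m, Subtype.ext hx.symm⟩, hxL⟩
      rw [hL] at this
      rw [← hx, show x = 0 from this]
      simp)
    exact Submodule.map_injective_of_injective E.injective_subtype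
      (this.trans (Submodule.map_bot _).symm)

end InjectiveHull

/-! ### Coresolutions and the dominant dimension -/

section Coresolution

variable {A : Type u} [Ring A]

/-- `HasCoresolution 𝒬 n M`: there is an exact sequence `0 → M → Q₀ → ⋯ → Qₙ₋₁` with all `Qᵢ`
in the class `𝒬`. -/
def HasCoresolution (𝒬 : ObjectProperty (ModuleCat.{u} A)) : ℕ → ModuleCat.{u} A → Prop
  | 0, _ => True
  | n + 1, M => ∃ (Q C : ModuleCat.{u} A) (f : M →ₗ[A] Q) (g : Q →ₗ[A] C),
      𝒬 Q ∧ Function.Injective f ∧ Function.Surjective g ∧ Function.Exact f g ∧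
        HasCoresolution 𝒬 n C

lemma HasCoresolution.of_le {𝒬 : ObjectProperty (ModuleCat.{u} A)}
    {m n : ℕ} (hmn : m ≤ n) {M : ModuleCat.{u} A} (h : HasCoresolution 𝒬 n M) :
    HasCoresolution 𝒬 m M := by
  induction n generalizing M m with
  | zero => obtain rfl : m = 0 := by omega
            trivial
  | succ n ih =>
    obtain _ | m := m
    · trivial
    obtain ⟨Q, C, f, g, hQ, hf, hg, hfg, hC⟩ := h
    exact ⟨Q, C, f, g, hQ, hf, hg, hfg, ih (by omega) hC⟩

lemma HasCoresolution.of_linearEquiv {𝒬 : ObjectProperty (ModuleCat.{u} A)}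
    {n : ℕ} {M N : ModuleCat.{u} A} (h : HasCoresolution 𝒬 n M) (e : M ≃ₗ[A] N) :
    HasCoresolution 𝒬 n N := by
  cases n with
  | zero => trivial
  | succ n =>
    obtain ⟨Q, C, f, g, hQ, hf, hg, hfg, hC⟩ := h
    refine ⟨Q, C, f ∘ₗ e.symm, g, hQ, hf.comp e.symm.injective, hg, ?_, hC⟩
    intro q
    rw [hfg q]
    exact (e.symm.surjective.range_comp f).symm ▸ Iff.rfl

variable (A) in
/-- The class of projective-injective modules. -/
def projInj : ObjectProperty (ModuleCat.{u} A) :=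
  fun Q => Module.Injective A Q ∧ Module.Projective A Q

lemma projInj_of_isInAdd {Q Q' : ModuleCat.{u} A} (h : IsInAdd A Q Q') (hQ : projInj A Q) :
    projInj A Q' :=
  have := hQ.1
  have := hQ.2
  ⟨h.injective, h.projective⟩

/-- An injective direct summand can be cancelled from the start of a projective-injective
coresolution. -/
lemma HasCoresolution.cancel {n : ℕ} {W M : ModuleCat.{u} A} (h : HasCoresolution (projInj A) n W)
    (j : M →ₗ[A] W) (s : W →ₗ[A] M) (hs : s ∘ₗ j = LinearMap.id)
    [Module.Injective A (LinearMap.ker s)] : HasCoresolution (projInj A) n M := by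
  cases n with
  | zero => trivial
  | succ n =>
    obtain ⟨Q, C, f, g, hQ, hf, hg, hfg, hC⟩ := h
    -- the injective module `ker s` splits off from `Q`, and `ker r` is the remaining summand
    have hsj : ∀ m, s (j m) = m := fun m => congrArg (fun l => l m) hs
    obtain ⟨r, hr⟩ := Module.Injective.extension_property A (LinearMap.ker s) (LinearMap.ker s) Q
      (f ∘ₗ (LinearMap.ker s).subtype) (hf.comp (LinearMap.ker s).injective_subtype)
      LinearMap.id
    have hr' : ∀ b : LinearMap.ker s, r (f b) = b := fun b => congrArg (fun l => l b) hr
    let p : Q →ₗ[A] Q := LinearMap.id - f ∘ₗ (LinearMap.ker s).subtype ∘ₗ r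
    have hp : ∀ q, p q = q - f (r q) := fun q => rfl
    have hrp : ∀ q, p q ∈ LinearMap.ker r := fun q => by
      simp [hp, hr']
    have hpf : ∀ b : LinearMap.ker s, p (f b) = 0 := fun b => by simp [hp, hr']
    have hpr : ∀ q ∈ LinearMap.ker r, p q = q := fun q hq => by
      simp [hp, LinearMap.mem_ker.1 hq]
    have hgf : ∀ w, g (f w) = 0 := fun w => (hfg _).2 ⟨w, rfl⟩
    have hgp : ∀ q, g (p q) = g q := fun q => by simp [hp, hgf]
    refine ⟨ModuleCat.of A (LinearMap.ker r), C, (p ∘ₗ f ∘ₗ j).codRestrict _ fun _ => hrp _,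
      g ∘ₗ (LinearMap.ker r).subtype,
      projInj_of_isInAdd (isInAdd_self.retract (LinearMap.ker r).subtype (p.codRestrict _ hrp)
        (by ext q; exact hpr q q.2)) hQ, ?_, ?_, ?_, hC⟩
    · rw [injective_iff_map_eq_zero]
      intro m hm
      have h1 : p (f (j m)) = 0 := congrArg Subtype.val hm
      rw [hp, ← map_sub] at h1
      have h2 : j m - (r (f (j m)) : W) = 0 := hf (by rw [h1, map_zero])
      have h3 := congrArg s h2
      rwa [map_sub, hsj, LinearMap.mem_ker.1 (r (f (j m))).2, sub_zero, map_zero] at h3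
    · intro c
      obtain ⟨q, rfl⟩ := hg c
      exact ⟨⟨p q, hrp q⟩, hgp q⟩
    · rintro ⟨q, hq⟩
      constructor
      · intro h
        obtain ⟨w, hw⟩ := (hfg q).1 h
        refine ⟨s w, Subtype.ext ?_⟩
        have hb : w - j (s w) ∈ LinearMap.ker s := by simp [hsj]
        have := hpf ⟨_, hb⟩
        simp only [map_sub] at this
        change p (f (j (s w))) = q
        rw [← sub_eq_zero.1 this, hw, hpr q hq]
      · rintro ⟨m, hm⟩
        have : p (f (j m)) = q := congrArg Subtype.val hm
        change g q = 0
        rw [← this, hgp, hgf]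

/-- A projective-injective coresolution of `M` forces the injective hull of `M` to be projective,
and passes to the cokernel of `M` in its hull. -/
lemma HasCoresolution.of_isEssential {n : ℕ} {M E D : ModuleCat.{u} A}
    (h : HasCoresolution (projInj A) (n + 1) M) [Module.Injective A E] (ι : M →ₗ[A] E)
    (p : E →ₗ[A] D) (hι : Function.Injective ι) (hess : IsEssential (LinearMap.range ι))
    (hp : Function.Surjective p) (hιp : Function.Exact ι p) :
    Module.Projective A E ∧ HasCoresolution (projInj A) n D := by
  obtain ⟨Q, C, f, g, hQ, hf, hg, hfg, hC⟩ := h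
  have := hQ.1
  have := hQ.2
  obtain ⟨k, hk⟩ := Module.Injective.extension_property A Q M E ι hι f
  have hkinj : Function.Injective k := hess.injective_of_comp k (by rw [hk]; exact hf)
  have hk' : ∀ m, k (ι m) = f m := fun m => congrArg (fun l => l m) hk
  obtain ⟨r, hr⟩ := Module.Injective.extension_property A E E Q k hkinj LinearMap.id
  have hr' : ∀ x, r (k x) = x := fun x => congrArg (fun l => l x) hr
  refine ⟨(isInAdd_self.retract (U := Q) k r hr).projective, ?_⟩
  have hgf : ∀ w, g (f w) = 0 := fun w => (hfg _).2 ⟨w, rfl⟩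
  have hpι : ∀ w, p (ι w) = 0 := fun w => (hιp _).2 ⟨w, rfl⟩
  -- the maps induced on cokernels by `k` and by its retraction `r`
  obtain ⟨j, hj⟩ : ∃ j : D →ₗ[A] C, ∀ x, j (p x) = g (k x) := by
    let e := p.quotKerEquivOfSurjective hp
    refine ⟨(LinearMap.ker p).liftQ (g ∘ₗ k) ?_ ∘ₗ e.symm.toLinearMap, fun x => ?_⟩
    · intro x hx
      obtain ⟨m, rfl⟩ := (hιp x).1 hx
      simp [hk', hgf]
    · have : e.symm (p x) = (LinearMap.ker p).mkQ x := by
        rw [LinearEquiv.symm_apply_eq]; rfl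
      simp [this]
  obtain ⟨s, hs⟩ : ∃ s : C →ₗ[A] D, ∀ x, s (g x) = p (r x) := by
    let e := g.quotKerEquivOfSurjective hg
    refine ⟨(LinearMap.ker g).liftQ (p ∘ₗ r) ?_ ∘ₗ e.symm.toLinearMap, fun x => ?_⟩
    · intro x hx
      obtain ⟨m, rfl⟩ := (hfg x).1 hx
      simp [← hk', hr', hpι]
    · have : e.symm (g x) = (LinearMap.ker g).mkQ x := by
        rw [LinearEquiv.symm_apply_eq]; rfl
      simp [this]
  -- `D` is a summand of `C`, with complement isomorphic to the complement `ker r` of `E` in `Q`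
  let φ : LinearMap.ker r →ₗ[A] LinearMap.ker s := (g ∘ₗ (LinearMap.ker r).subtype).codRestrict _
    fun x => by simp [hs]
  have hφ : Function.Bijective φ := by
    constructor
    · rw [injective_iff_map_eq_zero]
      rintro ⟨q, hq⟩ h
      obtain ⟨m, rfl⟩ := (hfg q).1 (congrArg Subtype.val h)
      rw [LinearMap.mem_ker, ← hk', hr'] at hq
      apply Subtype.ext
      change f m = 0
      rw [← hk', hq, map_zero]
    · rintro ⟨c, hc⟩
      obtain ⟨q, rfl⟩ := hg c
      rw [LinearMap.mem_ker, hs] at hc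
      obtain ⟨m, hm⟩ := (hιp _).1 hc
      refine ⟨⟨q - f m, ?_⟩, Subtype.ext ?_⟩
      · rw [LinearMap.mem_ker, map_sub, ← hk', hr', hm, sub_self]
      · change g (q - f m) = g q
        rw [map_sub, hgf, sub_zero]
  have hker : IsInAdd A Q (LinearMap.ker r) :=
    isInAdd_self.retract (LinearMap.ker r).subtype
      ((LinearMap.id - k ∘ₗ r).codRestrict _ fun x => by simp [hr']) (by
        ext x
        simp)
  have : Module.Injective A (LinearMap.ker s) :=
    (hker.of_linearEquiv (LinearEquiv.ofBijective φ hφ)).injective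
  refine hC.cancel j s ?_
  ext x
  obtain ⟨x, rfl⟩ := hp x
  simp [hj, hs, hr']

/-- An injective hull of `M`. -/
noncomputable def injectiveHull (M : ModuleCat.{u} A) : ModuleCat.{u} A :=
  (exists_injective_hull A M).choose

/-- The embedding of `M` into its injective hull. -/
noncomputable def toInjectiveHull (M : ModuleCat.{u} A) : M →ₗ[A] injectiveHull M :=
  (exists_injective_hull A M).choose_spec.choose

lemma toInjectiveHull_spec (M : ModuleCat.{u} A) : Module.Injective A (injectiveHull M) ∧
    Function.Injective (toInjectiveHull M) ∧ IsEssential (LinearMap.range (toInjectiveHull M)) :=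
  (exists_injective_hull A M).choose_spec.choose_spec

/-- The cosyzygies of `M` in a minimal injective resolution. -/
noncomputable def cosyzygy (M : ModuleCat.{u} A) : ℕ → ModuleCat.{u} A
  | 0 => M
  | n + 1 => ModuleCat.of A (injectiveHull (cosyzygy M n) ⧸
      LinearMap.range (toInjectiveHull (cosyzygy M n)))

/-- The projection of an injective hull onto the next cosyzygy. -/
noncomputable def toCosyzygy (M : ModuleCat.{u} A) (n : ℕ) :
    injectiveHull (cosyzygy M n) →ₗ[A] cosyzygy M (n + 1) :=
  (LinearMap.range (toInjectiveHull (cosyzygy M n))).mkQ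

lemma toCosyzygy_surjective (M : ModuleCat.{u} A) (n : ℕ) :
    Function.Surjective (toCosyzygy M n) :=
  Submodule.mkQ_surjective _

lemma exact_toCosyzygy (M : ModuleCat.{u} A) (n : ℕ) :
    Function.Exact (toInjectiveHull (cosyzygy M n)) (toCosyzygy M n) :=
  fun _ => Submodule.Quotient.mk_eq_zero _

/-- The minimal injective resolution obtained by taking injective hulls of successive
cosyzygies. -/
noncomputable def minimalInjectiveResolution (M : ModuleCat.{u} A) :
    MinimalInjectiveResolution M where
  I n := injectiveHull (cosyzygy M n)
  ι := toInjectiveHull (cosyzygy M 0)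
  δ n := toInjectiveHull (cosyzygy M (n + 1)) ∘ₗ toCosyzygy M n
  injective n := (toInjectiveHull_spec _).1
  ι_injective := (toInjectiveHull_spec (cosyzygy M 0)).2.1
  exact_zero x := by
    rw [LinearMap.comp_apply, map_eq_zero_iff _ (toInjectiveHull_spec _).2.1]
    exact exact_toCosyzygy M 0 x
  exact_succ n x := by
    rw [LinearMap.comp_apply, map_eq_zero_iff _ (toInjectiveHull_spec _).2.1, LinearMap.coe_comp,
      (toCosyzygy_surjective M n).range_comp]
    exact exact_toCosyzygy M (n + 1) x
  essential_zero := (toInjectiveHull_spec (cosyzygy M 0)).2.2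
  essential_succ n := by
    rw [LinearMap.range_comp_of_range_eq_top _
      (LinearMap.range_eq_top.2 (toCosyzygy_surjective M n))]
    exact (toInjectiveHull_spec _).2.2

lemma projective_minimalInjectiveResolution {M : ModuleCat.{u} A} {n k : ℕ}
    (h : HasCoresolution (projInj A) n (cosyzygy M k)) (i : ℕ) (hi : i < n) :
    Module.Projective A ((minimalInjectiveResolution M).I (k + i)) := by
  induction n generalizing k i with
  | zero => omega
  | succ n ih =>
    obtain ⟨h1, h2, h3⟩ := toInjectiveHull_spec (cosyzygy M k)
    obtain ⟨h4, h5⟩ := h.of_isEssential _ (toCosyzygy M k) h2 h3 (toCosyzygy_surjective M k)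
      (exact_toCosyzygy M k)
    obtain _ | i := i
    · exact h4
    · rw [show k + (i + 1) = k + 1 + i by omega]
      exact ih h5 i (by omega)

/-- Any coresolution by projective-injective modules, minimal or not, bounds the dominant
dimension from below. -/
lemma le_dominantDimension_of_hasCoresolution {n : ℕ}
    (h : HasCoresolution (projInj A) n (ModuleCat.of A A)) : (n : ℕ∞) ≤ dominantDimension A :=
  le_iSup₂_of_le n ⟨minimalInjectiveResolution _, fun i hi => by
    have := projective_minimalInjectiveResolution (M := ModuleCat.of A A) (k := 0) h i hi
    rwa [zero_add] at this⟩ le_rfl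

/-- The supremum defining the dominant dimension is attained up to any finite bound. -/
lemma exists_of_le_dominantDimension {n : ℕ} (h : (n : ℕ∞) ≤ dominantDimension A) :
    ∃ J : MinimalInjectiveResolution (ModuleCat.of A A), ∀ i < n, Module.Projective A (J.I i) := by
  by_contra! hn
  obtain _ | n := n
  · obtain ⟨i, hi, -⟩ := hn (minimalInjectiveResolution _)
    omega
  · have : dominantDimension A ≤ n := by
      refine iSup₂_le fun m hm => ?_
      obtain ⟨J, hJ⟩ := hm
      by_contra! hlt
      obtain ⟨i, hi, hi'⟩ := hn J
      have : n < m := by exact_mod_cast hlt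
      exact hi' (hJ i (by omega))
    have := h.trans this
    have : n + 1 ≤ n := by exact_mod_cast this
    omega

end Coresolution

/-! ### The functor `Hom(U, -)` -/

section HomFunctor

variable {A : Type u} [Ring A]
variable {U M N Y Z I : Type u} [AddCommGroup U] [Module A U] [AddCommGroup M] [Module A M]
  [AddCommGroup N] [Module A N] [AddCommGroup Y] [Module A Y] [AddCommGroup Z] [Module A Z]
  [AddCommGroup I] [Module A I]

/-- The endomorphism ring of `U` with composition written from left to right. -/
abbrev EndOp (A U : Type u) [Ring A] [AddCommGroup U] [Module A U] : Type u :=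
  (Module.End A U)ᵐᵒᵖ

/-- `Hom(U, Y)` is a left module over `EndOp A U` by precomposition. -/
instance homModule : Module (EndOp A U) (U →ₗ[A] Y) where
  smul b f := f ∘ₗ b.unop
  one_smul _ := rfl
  mul_smul _ _ _ := rfl
  smul_zero _ := rfl
  smul_add _ _ _ := rfl
  add_smul b c f := LinearMap.comp_add b.unop c.unop f
  zero_smul f := LinearMap.comp_zero f

lemma homModule_smul_def (b : EndOp A U) (f : U →ₗ[A] Y) : b • f = f ∘ₗ b.unop := rfl

lemma op_smul_hom (b : U →ₗ[A] U) (f : U →ₗ[A] Y) :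
    (MulOpposite.op b : EndOp A U) • f = f ∘ₗ b := rfl

variable (U) in
/-- The action of `Hom(U, -)` on morphisms. -/
def homMap (g : Y →ₗ[A] Z) : (U →ₗ[A] Y) →ₗ[EndOp A U] (U →ₗ[A] Z) where
  toFun f := g ∘ₗ f
  map_add' f f' := LinearMap.comp_add f f' g
  map_smul' _ _ := rfl

@[simp] lemma homMap_apply (g : Y →ₗ[A] Z) (f : U →ₗ[A] Y) : homMap U g f = g ∘ₗ f := rfl

lemma homMap_comp (g : Y →ₗ[A] Z) (h : Z →ₗ[A] M) :
    homMap U (h ∘ₗ g) = homMap U h ∘ₗ homMap U g := rfl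

lemma homMap_injective {g : Y →ₗ[A] Z} (hg : Function.Injective g) :
    Function.Injective (homMap U g) := fun f f' h => by
  ext x
  exact hg (congrArg (fun l => l x) h)

lemma homMap_exact {f : M →ₗ[A] Y} {g : Y →ₗ[A] Z} (hf : Function.Injective f)
    (h : Function.Exact f g) : Function.Exact (homMap U f) (homMap U g) := by
  intro y
  constructor
  · intro hy
    let e := LinearEquiv.ofInjective f hf
    refine ⟨e.symm.toLinearMap ∘ₗ y.codRestrict (LinearMap.range f) fun x =>
      (h _).1 (congrArg (fun l => l x) hy), ?_⟩
    ext x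
    exact congrArg Subtype.val (e.apply_symm_apply _)
  · rintro ⟨m, rfl⟩
    ext x
    exact (h _).2 ⟨m x, rfl⟩

variable (A U) in
/-- `Hom(U, U)` is the free module of rank one. -/
def homSelfEquiv : (U →ₗ[A] U) ≃ₗ[EndOp A U] EndOp A U where
  toFun f := MulOpposite.op f
  invFun b := b.unop
  map_add' _ _ := rfl
  map_smul' _ _ := rfl
  left_inv _ := rfl
  right_inv _ := rfl

lemma IsInAdd.hom (h : IsInAdd A Y N) :
    IsInAdd (EndOp A U) (U →ₗ[A] Y) (U →ₗ[A] N) := by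
  obtain ⟨n, t, s, h⟩ := h.exists_sum
  refine .of_sum (fun i => homMap U (t i)) (fun i => homMap U (s i)) ?_
  ext f x
  simpa using congrArg (fun l => l (f x)) h

lemma IsInAdd.hom_self (h : IsInAdd A U N) : IsInAdd (EndOp A U) (EndOp A U) (U →ₗ[A] N) :=
  h.hom.trans (isInAdd_self.of_linearEquiv (homSelfEquiv A U).symm)

/-- Yoneda: for `Y ∈ add U`, all maps out of `Hom(U, Y)` come from maps out of `Y`. -/
lemma IsInAdd.exists_homMap_eq (h : IsInAdd A U Y)
    (φ : (U →ₗ[A] Y) →ₗ[EndOp A U] (U →ₗ[A] Z)) : ∃ ψ : Y →ₗ[A] Z, homMap U ψ = φ := by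
  obtain ⟨n, t, s, h⟩ := h.exists_sum
  refine ⟨∑ i, φ (s i) ∘ₗ t i, ?_⟩
  ext1 y
  have : y = ∑ i, (MulOpposite.op (t i ∘ₗ y) : EndOp A U) • s i := by
    ext x
    simpa [op_smul_hom] using (congrArg (fun l => l (y x)) h).symm
  conv_rhs => rw [this]
  rw [map_sum]
  simp only [map_smul]
  ext x
  simp [op_smul_hom]

lemma IsInAdd.hom_ext (h : IsInAdd A U Y) {f g : Y →ₗ[A] Z}
    (hfg : ∀ s : U →ₗ[A] Y, f ∘ₗ s = g ∘ₗ s) : f = g := by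
  obtain ⟨n, t, s, h⟩ := h.exists_sum
  ext y
  rw [← show (∑ i, s i ∘ₗ t i) y = y from congrArg (fun l => l y) h, LinearMap.sum_apply, map_sum,
    map_sum]
  exact Finset.sum_congr rfl fun i _ => congrArg (fun l => l (t i y)) (hfg (s i))

/-- `U` separates maps into `I`: a map into `I` that vanishes on all images of `U` is zero. -/
def Separates (A U I : Type u) [Ring A] [AddCommGroup U] [Module A U] [AddCommGroup I]
    [Module A I] : Prop :=
  ∀ (K : Type u) [AddCommGroup K] [Module A K] (g : K →ₗ[A] I),
    (∀ s : U →ₗ[A] K, g ∘ₗ s = 0) → g = 0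

lemma separates_of_isInAdd (h : IsInAdd A U A) : Separates A U I := by
  intro K _ _ g hg
  ext k
  have := h.hom_ext (f := g ∘ₗ LinearMap.toSpanSingleton A K k) (g := 0) fun s => by
    rw [LinearMap.comp_assoc, hg, LinearMap.zero_comp]
  simpa using congrArg (fun l => l 1) this

lemma exists_support_subset [Module.Finite A U] {S : Type*} (s : U →ₗ[A] (S →₀ N)) :
    ∃ T : Finset S, ∀ u, (s u).support ⊆ T := by
  classical
  obtain ⟨G, hG⟩ := Module.Finite.fg_top (R := A) (M := U)
  let T := G.biUnion fun g => (s g).support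
  have : (⊤ : Submodule A U) ≤ (Finsupp.supported N A (T : Set S)).comap s := by
    rw [← hG, Submodule.span_le]
    intro g hg
    change s g ∈ Finsupp.supported N A (T : Set S)
    rw [Finsupp.mem_supported]
    exact_mod_cast Finset.subset_biUnion_of_mem (fun g => (s g).support) hg
  refine ⟨T, fun u => ?_⟩
  have h := this (Submodule.mem_top (x := u))
  rw [Submodule.mem_comap, Finsupp.mem_supported] at h
  exact_mod_cast h

/-- Evaluation of a family of maps `U → M` indexed by a submodule of `Hom(U, M)`, twisted by
a linear map `φ` into `Hom(U, N)`. -/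
noncomputable def evalSum {S : Submodule (EndOp A U) (U →ₗ[A] M)}
    (φ : S →ₗ[EndOp A U] (U →ₗ[A] N)) : (S →₀ U) →ₗ[A] N :=
  Finsupp.lsum ℕ fun s => φ s

/-- On the image of a map from the finitely generated module `U`, evaluation is composition with an
element of `S`, independently of the twist. -/
lemma exists_evalSum_comp_eq [Module.Finite A U] {S : Submodule (EndOp A U) (U →ₗ[A] M)}
    (s : U →ₗ[A] (S →₀ U)) : ∃ x : S, ∀ {N : Type u} [AddCommGroup N] [Module A N]
      (φ : S →ₗ[EndOp A U] (U →ₗ[A] N)), evalSum φ ∘ₗ s = φ x := by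
  obtain ⟨T, hT⟩ := exists_support_subset s
  refine ⟨∑ t ∈ T, (MulOpposite.op (Finsupp.lapply t ∘ₗ s) : EndOp A U) • t, fun φ => ?_⟩
  ext u
  rw [map_sum, LinearMap.comp_apply, evalSum, Finsupp.lsum_apply,
    Finsupp.sum_of_support_subset _ (hT u) _ (by simp), LinearMap.sum_apply]
  refine Finset.sum_congr rfl fun t _ => ?_
  rw [map_smul, op_smul_hom]
  rfl

/-- The relations between the maps in `S` that are visible to the finitely generated module `U`
are preserved by every `EndOp A U`-linear map `φ`. -/
lemma evalSum_comp_eq_zero [Module.Finite A U] {S : Submodule (EndOp A U) (U →ₗ[A] M)}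
    (φ : S →ₗ[EndOp A U] (U →ₗ[A] N)) (s : U →ₗ[A] (S →₀ U))
    (hs : evalSum S.subtype ∘ₗ s = 0) : evalSum φ ∘ₗ s = 0 := by
  obtain ⟨x, hx⟩ := exists_evalSum_comp_eq s
  rw [hx] at hs ⊢
  rw [show x = 0 from Subtype.ext hs, map_zero]

lemma evalSum_ker_le [Module.Finite A U] {S : Submodule (EndOp A U) (U →ₗ[A] M)}
    (φ : S →ₗ[EndOp A U] (U →ₗ[A] N)) (h : Separates A U N) :
    LinearMap.ker (evalSum S.subtype) ≤ LinearMap.ker (evalSum φ) := by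
  intro x hx
  have := h (LinearMap.ker (evalSum S.subtype)) (evalSum φ ∘ₗ Submodule.subtype _) fun s => by
    rw [LinearMap.comp_assoc]
    refine evalSum_comp_eq_zero φ _ ?_
    ext u
    exact (s u).2
  exact congrArg (fun l => l ⟨x, hx⟩) this

lemma evalSum_single {S : Submodule (EndOp A U) (U →ₗ[A] M)}
    (φ : S →ₗ[EndOp A U] (U →ₗ[A] N)) (s : S) (x : U) :
    evalSum φ (Finsupp.single s x) = φ s x := by
  simp [evalSum]

lemma exists_comp_eq_of_ker_le [Module.Injective A I] (f : M →ₗ[A] N) (g : M →ₗ[A] I)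
    (h : LinearMap.ker f ≤ LinearMap.ker g) : ∃ ψ : N →ₗ[A] I, ψ ∘ₗ f = g := by
  obtain ⟨ψ, hψ⟩ := Module.Injective.extension_property A I (M ⧸ LinearMap.ker f) N
    ((LinearMap.ker f).liftQ f le_rfl)
    (LinearMap.ker_eq_bot.1 (Submodule.ker_liftQ_eq_bot _ _ _ le_rfl)) ((LinearMap.ker f).liftQ g h)
  refine ⟨ψ, ?_⟩
  ext x
  simpa using congrArg (fun l => l ((LinearMap.ker f).mkQ x)) hψ

/-- Linear maps from a submodule of `Hom(U, M)` to `Hom(U, I)`, with `I` injective and separated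
by `U`, are given by composition with a map `M → I`. -/
lemma exists_comp_eq_of_injective [Module.Finite A U] [Module.Injective A I]
    (h : Separates A U I) {S : Submodule (EndOp A U) (U →ₗ[A] M)}
    (φ : S →ₗ[EndOp A U] (U →ₗ[A] I)) : ∃ ψ : M →ₗ[A] I, ∀ s : S, ψ ∘ₗ (s : U →ₗ[A] M) = φ s := by
  obtain ⟨ψ, hψ⟩ := exists_comp_eq_of_ker_le _ _ (evalSum_ker_le φ h)
  refine ⟨ψ, fun s => ?_⟩
  ext x
  have := congrArg (fun l => l (Finsupp.single s x)) hψ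
  simpa [evalSum_single] using this

/-- `Hom(U, I)` is injective over `EndOp A U` if `I` is injective and separated by `U`. -/
lemma injective_hom [Module.Finite A U] [Module.Injective A I]
    (h : Separates A U I) : Module.Injective (EndOp A U) (U →ₗ[A] I) := by
  refine Module.Baer.injective fun J g => ?_
  let e := homSelfEquiv A U
  let S : Submodule (EndOp A U) (U →ₗ[A] U) :=
    Submodule.comap (e : (U →ₗ[A] U) →ₗ[EndOp A U] EndOp A U) J
  obtain ⟨ψ, hψ⟩ := exists_comp_eq_of_injective h (S := S)
    (g ∘ₗ ((e : (U →ₗ[A] U) →ₗ[EndOp A U] EndOp A U).domRestrict S).codRestrict J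
      fun s => s.2)
  refine ⟨LinearMap.toSpanSingleton _ _ ψ, fun x hx => ?_⟩
  exact hψ ⟨x.unop, hx⟩

/-- Full faithfulness of `Hom(U, -)` on maps into an injective module separated by `U`. -/
lemma exists_homMap_eq_of_injective [Module.Finite A U] [Module.Injective A I]
    (h : Separates A U I) (φ : (U →ₗ[A] M) →ₗ[EndOp A U] (U →ₗ[A] I)) :
    ∃ ψ : M →ₗ[A] I, homMap U ψ = φ := by
  obtain ⟨ψ, hψ⟩ := exists_comp_eq_of_injective h (S := ⊤) (φ ∘ₗ Submodule.subtype _)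
  exact ⟨ψ, by ext1 s; exact hψ ⟨s, trivial⟩⟩

/-- `Hom(U, -)` is full on maps into a module copresented by injective modules separated
by `U`. -/
lemma exists_homMap_eq_of_copresentation [Module.Finite A U] {I₀ I₁ : Type u} [AddCommGroup I₀]
    [Module A I₀] [AddCommGroup I₁] [Module A I₁] [Module.Injective A I₀]
    (h₀ : Separates A U I₀) (h₁ : Separates A U I₁) {f : Y →ₗ[A] I₀} {g : I₀ →ₗ[A] I₁}
    (hf : Function.Injective f) (hfg : Function.Exact f g)
    (φ : (U →ₗ[A] M) →ₗ[EndOp A U] (U →ₗ[A] Y)) :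
    ∃ ψ : M →ₗ[A] Y, homMap U ψ = φ := by
  obtain ⟨ψ, hψ⟩ := exists_homMap_eq_of_injective h₀ (homMap U f ∘ₗ φ)
  have h0 : g ∘ₗ ψ = 0 := h₁ _ _ fun s => by
    have h2 : ψ ∘ₗ s = f ∘ₗ φ s := congrArg (fun l => l s) hψ
    rw [LinearMap.comp_assoc, h2]
    ext x
    exact (hfg _).2 ⟨_, rfl⟩
  obtain ⟨ψ', hψ'⟩ := (homMap_exact (U := M) hf hfg ψ).1 h0
  refine ⟨ψ', ?_⟩
  ext1 s
  apply homMap_injective hf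
  have : f ∘ₗ ψ' = ψ := hψ'
  change f ∘ₗ ψ' ∘ₗ s = _
  rw [← LinearMap.comp_assoc, this]
  exact congrArg (fun l => l s) hψ

lemma Separates.of_injective (h : Separates A U N) {f : M →ₗ[A] N} (hf : Function.Injective f) :
    Separates A U M := fun K _ _ g hg => by
  have := h K (f ∘ₗ g) fun s => by rw [LinearMap.comp_assoc, hg, LinearMap.comp_zero]
  ext x
  exact hf (by simpa using congrArg (fun l => l x) this)

lemma Separates.homMap_injective (h : Separates A U Y) {f g : M →ₗ[A] Y}
    (hfg : homMap U f = homMap U g) : f = g :=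
  sub_eq_zero.1 (h M (f - g) fun s => by
    rw [LinearMap.sub_comp, sub_eq_zero]
    exact congrArg (fun l => l s) hfg)

lemma Separates.of_isInAdd (h : Separates A U Y) (hN : IsInAdd A Y N) : Separates A U N := by
  obtain ⟨n, t, s, hst⟩ := hN.exists_sum
  intro K _ _ g hg
  have : ∀ i, t i ∘ₗ g = 0 := fun i => h K _ fun s => by
    rw [LinearMap.comp_assoc, hg, LinearMap.comp_zero]
  ext k
  have h1 := congrArg (fun l => l (g k)) hst
  simp only [LinearMap.sum_apply, LinearMap.comp_apply, LinearMap.id_apply] at h1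
  rw [← h1]
  exact Finset.sum_eq_zero fun i _ => by
    rw [show t i (g k) = 0 from congrArg (fun l => l k) (this i), map_zero]

end HomFunctor

/-! ### Finitely generated injective modules over Artin algebras -/

section CommArtinian

variable {R : Type u} [CommRing R]

/-- The elements of `E` annihilated by the `k`-th power of the Jacobson radical of `R`. -/
def socleSeries (R : Type u) [CommRing R] (E : Type u) [AddCommGroup E] [Module R E] :
    ℕ → Submodule R E
  | 0 => ⊥
  | k + 1 => ⨅ j ∈ Ring.jacobson R, (socleSeries R E k).comap (LinearMap.lsmul R E j)

variable {M E : Type u} [AddCommGroup M] [Module R M] [AddCommGroup E] [Module R E]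

lemma mem_socleSeries_succ {k : ℕ} {x : E} :
    x ∈ socleSeries R E (k + 1) ↔ ∀ j ∈ Ring.jacobson R, j • x ∈ socleSeries R E k := by
  simp [socleSeries]

lemma mem_socleSeries_of_pow {k : ℕ} {x : E} (hx : ∀ j ∈ Ring.jacobson R ^ k, j • x = 0) :
    x ∈ socleSeries R E k := by
  induction k generalizing x with
  | zero => simpa [socleSeries] using hx 1 (by simp)
  | succ k ih =>
    rw [mem_socleSeries_succ]
    intro j hj
    refine ih fun i hi => ?_
    rw [← mul_smul]
    exact hx _ (pow_succ (Ring.jacobson R) k ▸ Ideal.mul_mem_mul hi hj)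

variable [IsArtinianRing R]

/-- Over a commutative artinian ring, an essential submodule contains the socle. -/
lemma IsEssential.socle_le {N : Submodule R E} (hN : IsEssential N) :
    socleSeries R E 1 ≤ N := by
  intro x hx
  rw [mem_socleSeries_succ] at hx
  -- `x` generates a quotient of the semisimple module `R ⧸ J`, in which `N` has a complement
  let f : (R ⧸ Ring.jacobson R) →ₗ[R] E :=
    (Ring.jacobson R).liftQ (LinearMap.toSpanSingleton R E x) fun j hj => by
      simpa [socleSeries] using hx j hj
  have : IsSemisimpleModule R (R ⧸ Ring.jacobson R) :=
    (LinearMap.isSemisimpleModule_iff_of_bijective (σ := Ideal.Quotient.mk (Ring.jacobson R))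
      { toFun := id, map_add' := fun _ _ => rfl, map_smul' := fun r y => by
          obtain ⟨y, rfl⟩ := Ideal.Quotient.mk_surjective y; rfl }
      Function.bijective_id).2 inferInstance
  have : IsSemisimpleModule R (LinearMap.range f) := .range f
  obtain ⟨L, hL⟩ := exists_isCompl (N.comap (LinearMap.range f).subtype)
  have h0 : L.map (LinearMap.range f).subtype = ⊥ := hN _ (by
    rw [eq_bot_iff]
    rintro _ ⟨h1, ⟨y, hy, rfl⟩⟩
    have := Submodule.disjoint_def.1 hL.disjoint y h1 hy
    simp [this])
  have hL0 : L = ⊥ := Submodule.map_injective_of_injective (LinearMap.range f).injective_subtype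
    (h0.trans (Submodule.map_bot _).symm)
  rw [hL0] at hL
  have htop : N.comap (LinearMap.range f).subtype = ⊤ := by simpa using hL.sup_eq_top
  have hxf : x ∈ LinearMap.range f := ⟨(Ring.jacobson R).mkQ 1, one_smul R x⟩
  have : (⟨x, hxf⟩ : LinearMap.range f) ∈ N.comap (LinearMap.range f).subtype := htop ▸ trivial
  exact this

/-- Multiplication by generators of the radical embeds each term of the socle series, modulo a
submodule of the socle, into a power of the previous term. -/
lemma IsEssential.finite_socleSeries {N : Submodule R E} (hN : IsEssential N) [Module.Finite R N]
    (k : ℕ) : Module.Finite R (socleSeries R E k) := by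
  induction k with
  | zero => exact inferInstanceAs (Module.Finite R (⊥ : Submodule R E))
  | succ k ih =>
    obtain ⟨n, j, hj⟩ := Submodule.fg_iff_exists_fin_generating_family.1
      (IsNoetherian.noetherian (Ring.jacobson R))
    have hjmem : ∀ i, j i ∈ Ring.jacobson R := fun i => hj ▸ Submodule.subset_span ⟨i, rfl⟩
    let f : socleSeries R E (k + 1) →ₗ[R] (Fin n → socleSeries R E k) :=
      LinearMap.pi fun i => ((LinearMap.lsmul R E (j i)).domRestrict _).codRestrict _ fun x =>
        mem_socleSeries_succ.1 x.2 (j i) (hjmem i)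
    have hker : ∀ x ∈ LinearMap.ker f, (x : E) ∈ N := by
      intro x hx
      refine hN.socle_le (mem_socleSeries_succ.2 fun i hi => ?_)
      have h1 : ∀ i, j i • (x : E) = 0 := fun i =>
        congrArg Subtype.val (congrFun (LinearMap.mem_ker.1 hx) i)
      have h2 : Submodule.span R (Set.range j) ≤
          LinearMap.ker (LinearMap.toSpanSingleton R E (x : E)) := by
        rw [Submodule.span_le]
        rintro _ ⟨i, rfl⟩
        exact h1 i
      rw [hj] at h2
      exact h2 hi
    have : IsNoetherian R N := isNoetherian_of_isNoetherianRing_of_finite R N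
    have : IsNoetherian R (LinearMap.ker f) :=
      isNoetherian_of_injective
        (((socleSeries R E (k + 1)).subtype.domRestrict (LinearMap.ker f)).codRestrict N
          fun x => hker x x.2) (fun x y h => by
            have h' := congrArg Subtype.val h
            exact Subtype.ext (Subtype.ext h'))
    have : IsNoetherian R (socleSeries R E (k + 1)) :=
      isNoetherian_of_range_eq_ker (LinearMap.ker f).subtype f (Submodule.range_subtype _)
    infer_instance

/-- Over a commutative artinian ring, essential extensions of finitely generated modules are
finitely generated. -/
lemma IsEssential.finite {N : Submodule R E} (hN : IsEssential N) [Module.Finite R N] :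
    Module.Finite R E := by
  obtain ⟨n, hn⟩ := IsSemiprimaryRing.isNilpotent (R := R)
  have h := hN.finite_socleSeries n
  have : socleSeries R E n = ⊤ := by
    rw [eq_top_iff]
    intro x _
    refine mem_socleSeries_of_pow fun j hj => ?_
    rw [hn] at hj
    rw [show j = 0 from hj, zero_smul]
  rw [this] at h
  exact Module.Finite.of_surjective (⊤ : Submodule R E).subtype fun x => ⟨⟨x, trivial⟩, rfl⟩

lemma exists_finite_injective_of_commRing (M : Type u) [AddCommGroup M] [Module R M]
    [Module.Finite R M] : ∃ (W : ModuleCat.{u} R) (f : M →ₗ[R] W), Module.Injective R W ∧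
      Module.Finite R W ∧ Function.Injective f := by
  obtain ⟨W, f, h1, h2, h3⟩ := exists_injective_hull R M
  exact ⟨W, f, h1, h3.finite, h2⟩

end CommArtinian

section Coinduced

variable (R : Type u) [CommRing R] (Λ : Type u) [Ring Λ] [Algebra R Λ] (W : Type u)
  [AddCommGroup W] [Module R W]

/-- The coinduced module `Hom_R(Λ, W)`, with `Λ` acting through right multiplication on the
argument. -/
def Coinduced : Type u := Λ →ₗ[R] W

instance : AddCommGroup (Coinduced R Λ W) := inferInstanceAs (AddCommGroup (Λ →ₗ[R] W))
instance : Module R (Coinduced R Λ W) := inferInstanceAs (Module R (Λ →ₗ[R] W))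

variable {R Λ W} in
/-- An element of a coinduced module, as a linear map. -/
def Coinduced.toHom (f : Coinduced R Λ W) : Λ →ₗ[R] W := f

variable {R Λ W} in
@[ext] lemma Coinduced.ext {f g : Coinduced R Λ W} (h : ∀ a, f.toHom a = g.toHom a) : f = g :=
  LinearMap.ext h

instance : SMul Λ (Coinduced R Λ W) := ⟨fun a f => f.toHom ∘ₗ LinearMap.mulRight R a⟩

variable {R Λ W}

@[simp] lemma Coinduced.toHom_smul (a b : Λ) (f : Coinduced R Λ W) :
    (a • f).toHom b = f.toHom (b * a) := rfl
@[simp] lemma Coinduced.toHom_smul' (r : R) (b : Λ) (f : Coinduced R Λ W) :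
    (r • f).toHom b = r • f.toHom b := rfl
@[simp] lemma Coinduced.toHom_zero (b : Λ) : (0 : Coinduced R Λ W).toHom b = 0 := rfl
@[simp] lemma Coinduced.toHom_add (b : Λ) (f g : Coinduced R Λ W) :
    (f + g).toHom b = f.toHom b + g.toHom b := rfl

instance : Module Λ (Coinduced R Λ W) where
  one_smul f := by ext; simp
  mul_smul a b f := by ext; simp [mul_assoc]
  smul_zero _ := rfl
  smul_add _ _ _ := rfl
  add_smul a b f := by ext; simp [mul_add]
  zero_smul f := by ext; simp

instance : IsScalarTower R Λ (Coinduced R Λ W) where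
  smul_assoc r a f := by ext; simp

/-- The `Λ`-linear map into a coinduced module corresponding to an `R`-linear map. -/
def Coinduced.lift {Y : Type u} [AddCommGroup Y] [Module Λ Y] [Module R Y] [IsScalarTower R Λ Y]
    (ψ : Y →ₗ[R] W) : Y →ₗ[Λ] Coinduced R Λ W where
  toFun y := ψ ∘ₗ (LinearMap.toSpanSingleton Λ Y y).restrictScalars R
  map_add' y z := Coinduced.ext fun a => by
    change ψ (a • (y + z)) = ψ (a • y) + ψ (a • z)
    rw [smul_add, map_add]
  map_smul' b y := Coinduced.ext fun a => by
    change ψ (a • b • y) = ψ ((a * b) • y)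
    rw [mul_smul]

lemma Coinduced.toHom_lift {Y : Type u} [AddCommGroup Y] [Module Λ Y] [Module R Y]
    [IsScalarTower R Λ Y] (ψ : Y →ₗ[R] W) (y : Y) (a : Λ) :
    (Coinduced.lift (Λ := Λ) ψ y).toHom a = ψ (a • y) := rfl

/-- Coinduction is right adjoint to restriction of scalars, hence preserves injectives. -/
instance [Module.Injective R W] : Module.Injective Λ (Coinduced R Λ W) where
  out X Y _ _ _ _ f hf g := by
    let := Module.compHom X (algebraMap R Λ)
    let := Module.compHom Y (algebraMap R Λ)
    have : IsScalarTower R Λ X := ⟨fun r a x => by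
      rw [Algebra.smul_def, mul_smul]; rfl⟩
    have : IsScalarTower R Λ Y := ⟨fun r a x => by
      rw [Algebra.smul_def, mul_smul]; rfl⟩
    let g₁ : X →ₗ[R] W :=
      { toFun := fun x => (g x).toHom 1
        map_add' := fun x y => by simp
        map_smul' := fun r x => by
          have : g (r • x) = r • g x := (g.restrictScalars R).map_smul r x
          simp [this] }
    obtain ⟨ψ, hψ⟩ := Module.Injective.extension_property R W X Y (f.restrictScalars R) hf g₁
    refine ⟨Coinduced.lift ψ, fun x => Coinduced.ext fun a => ?_⟩
    rw [Coinduced.toHom_lift, ← f.map_smul]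
    refine (LinearMap.congr_fun hψ (a • x)).trans ?_
    change (g (a • x)).toHom 1 = _
    rw [g.map_smul, Coinduced.toHom_smul, one_mul]

end Coinduced

section HomFinite

variable {R : Type v} [CommRing R] {Λ : Type u} [Ring Λ] [Algebra R Λ] {X Y : Type u}
  [AddCommGroup X] [Module Λ X] [AddCommGroup Y] [Module Λ Y] [Module R Y] [IsScalarTower R Λ Y]

lemma finite_hom [IsNoetherianRing R] [Module.Finite R Λ] [Module.Finite Λ X] [Module.Finite Λ Y] :
    Module.Finite R (X →ₗ[Λ] Y) := by
  obtain ⟨n, x, hx⟩ := Module.Finite.exists_fin (R := Λ) (M := X)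
  have : Module.Finite R Y := Module.Finite.trans Λ Y
  let f : (X →ₗ[Λ] Y) →ₗ[R] (Fin n → Y) :=
    { toFun := fun g i => g (x i), map_add' := fun _ _ => rfl, map_smul' := fun _ _ => rfl }
  have hf : Function.Injective f := fun g h hgh =>
    LinearMap.ext_on_range hx fun i => congrFun hgh i
  have := isNoetherian_of_injective f hf
  infer_instance

end HomFinite

section ArtinAlgebra

variable {Λ : Type u} [Ring Λ]

lemma isScalarTower_compHom (R : Type v) [CommRing R] [Algebra R Λ] (Y : Type u)
    [AddCommGroup Y] [Module Λ Y] :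
    letI := Module.compHom Y (algebraMap R Λ)
    IsScalarTower R Λ Y :=
  letI := Module.compHom Y (algebraMap R Λ)
  ⟨fun r a x => by rw [Algebra.smul_def, mul_smul]; rfl⟩

lemma IsArtinAlgebra.isNoetherianRing (h : IsArtinAlgebra Λ) : IsNoetherianRing Λ := by
  obtain ⟨R, _, _, _, _⟩ := h
  exact isNoetherian_of_tower R inferInstance

lemma IsArtinAlgebra.isArtinianRing (h : IsArtinAlgebra Λ) : IsArtinianRing Λ := by
  obtain ⟨R, _, _, _, _⟩ := h
  exact isArtinian_of_tower R inferInstance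

/-- Finitely generated modules over an Artin algebra embed into finitely generated injective
modules. -/
lemma IsArtinAlgebra.exists_finite_injective (h : IsArtinAlgebra Λ) (N : Type u) [AddCommGroup N]
    [Module Λ N] [Module.Finite Λ N] : ∃ (W : ModuleCat.{u} Λ) (f : N →ₗ[Λ] W),
      Module.Injective Λ W ∧ Module.Finite Λ W ∧ Function.Injective f := by
  obtain ⟨R, _, _, _, _⟩ := h
  let := Module.compHom N (algebraMap R Λ)
  have : IsScalarTower R Λ N := isScalarTower_compHom R N
  have : Module.Finite R N := Module.Finite.trans Λ N
  obtain ⟨W, f, _, _, hf⟩ := exists_finite_injective_of_commRing (R := R) N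
  refine ⟨ModuleCat.of Λ (Coinduced R Λ W), Coinduced.lift f, ?_, ?_, ?_⟩
  · exact inferInstanceAs (Module.Injective Λ (Coinduced R Λ W))
  · have : Module.Finite R (Coinduced R Λ W) :=
      finite_hom (R := R) (Λ := R) (X := Λ) (Y := W)
    exact Module.Finite.of_restrictScalars_finite R Λ (Coinduced R Λ W)
  · intro x y hxy
    have h1 : f ((1 : Λ) • x) = f ((1 : Λ) • y) :=
      congrArg (fun l : Coinduced R Λ W => l.toHom 1) hxy
    rw [one_smul, one_smul] at h1
    exact hf h1

/-- Over an Artin algebra, essential extensions of finitely generated modules are finitely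
generated. -/
lemma IsArtinAlgebra.finite_of_isEssential (h : IsArtinAlgebra Λ) {N E : Type u} [AddCommGroup N]
    [Module Λ N] [AddCommGroup E] [Module Λ E] [Module.Finite Λ N] (ι : N →ₗ[Λ] E)
    (hι : Function.Injective ι) (hess : IsEssential (LinearMap.range ι)) : Module.Finite Λ E := by
  obtain ⟨W, f, _, _, hf⟩ := h.exists_finite_injective N
  have := h.isNoetherianRing
  obtain ⟨k, hk⟩ := Module.Injective.extension_property Λ W N E ι hι f
  exact Module.Finite.of_injective k (hess.injective_of_comp k (by rwa [hk]))

/-- The finite generation of `Hom(X, M)` over the base provides right `add X`-approximations. -/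
lemma IsArtinAlgebra.exists_right_approx (h : IsArtinAlgebra Λ) (X M : Type u) [AddCommGroup X]
    [Module Λ X] [AddCommGroup M] [Module Λ M] [Module.Finite Λ X] [Module.Finite Λ M] :
    ∃ (n : ℕ) (f : (Fin n → X) →ₗ[Λ] M), ∀ Y : ModuleCat.{u} Λ, IsInAdd Λ X Y →
      ∀ g : Y →ₗ[Λ] M, ∃ k : Y →ₗ[Λ] (Fin n → X), f ∘ₗ k = g := by
  obtain ⟨R, _, _, _, _⟩ := h
  let := Module.compHom M (algebraMap R Λ)
  have : IsScalarTower R Λ M := isScalarTower_compHom R M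
  let := Module.compHom X (algebraMap R Λ)
  have : IsScalarTower R Λ X := isScalarTower_compHom R X
  have : Module.Finite R (X →ₗ[Λ] M) := finite_hom
  obtain ⟨n, s, hs⟩ := Module.Finite.exists_fin (R := R) (M := X →ₗ[Λ] M)
  let F : (Fin n → X) →ₗ[Λ] M := ∑ i, s i ∘ₗ LinearMap.proj i
  have hF : ∀ g : X →ₗ[Λ] M, ∃ k : X →ₗ[Λ] (Fin n → X), F ∘ₗ k = g := by
    intro g
    obtain ⟨c, rfl⟩ := (Submodule.mem_span_range_iff_exists_fun R).1 (hs ▸ trivial :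
      g ∈ Submodule.span R (Set.range s))
    refine ⟨LinearMap.pi fun i => c i • LinearMap.id, ?_⟩
    ext x
    simp only [F, LinearMap.comp_apply, LinearMap.sum_apply, LinearMap.proj_apply,
      LinearMap.pi_apply, LinearMap.smul_apply, LinearMap.id_apply]
    exact Finset.sum_congr rfl fun i _ => ((s i).restrictScalars R).map_smul _ _
  refine ⟨n, F, fun Y hY g => ?_⟩
  obtain ⟨m, t, r, htr⟩ := hY.exists_sum
  choose k hk using fun i => hF (g ∘ₗ r i)
  refine ⟨∑ i, k i ∘ₗ t i, ?_⟩
  ext y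
  have h1 := congrArg (fun l => g (l y)) htr
  have h2 : ∀ i, F (k i (t i y)) = g (r i (t i y)) := fun i => LinearMap.congr_fun (hk i) _
  simp only [LinearMap.sum_apply, LinearMap.comp_apply, map_sum, LinearMap.id_apply] at h1
  simp only [LinearMap.sum_apply, LinearMap.comp_apply, map_sum, h2, h1]

/-- The finite generation of `Hom(M, X)` over the base provides left `add X`-approximations. -/
lemma IsArtinAlgebra.exists_left_approx (h : IsArtinAlgebra Λ) (X M : Type u) [AddCommGroup X]
    [Module Λ X] [AddCommGroup M] [Module Λ M] [Module.Finite Λ X] [Module.Finite Λ M] :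
    ∃ (n : ℕ) (f : M →ₗ[Λ] (Fin n → X)), ∀ Y : ModuleCat.{u} Λ, IsInAdd Λ X Y →
      ∀ g : M →ₗ[Λ] Y, ∃ k : (Fin n → X) →ₗ[Λ] Y, k ∘ₗ f = g := by
  obtain ⟨R, _, _, _, _⟩ := h
  let := Module.compHom X (algebraMap R Λ)
  have : IsScalarTower R Λ X := isScalarTower_compHom R X
  have : Module.Finite R (M →ₗ[Λ] X) := finite_hom
  obtain ⟨n, s, hs⟩ := Module.Finite.exists_fin (R := R) (M := M →ₗ[Λ] X)
  let F : M →ₗ[Λ] (Fin n → X) := LinearMap.pi s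
  have hF : ∀ g : M →ₗ[Λ] X, ∃ k : (Fin n → X) →ₗ[Λ] X, k ∘ₗ F = g := by
    intro g
    obtain ⟨c, rfl⟩ := (Submodule.mem_span_range_iff_exists_fun R).1 (hs ▸ trivial :
      g ∈ Submodule.span R (Set.range s))
    refine ⟨∑ i, c i • LinearMap.proj i, ?_⟩
    ext x
    simp [F]
  refine ⟨n, F, fun Y hY g => ?_⟩
  obtain ⟨m, t, r, htr⟩ := hY.exists_sum
  choose k hk using fun i => hF (t i ∘ₗ g)
  refine ⟨∑ i, r i ∘ₗ k i, ?_⟩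
  ext y
  have h1 := congrArg (fun l => l (g y)) htr
  have h2 : ∀ i, k i (F y) = t i (g y) := fun i => LinearMap.congr_fun (hk i) _
  simp only [LinearMap.sum_apply, LinearMap.comp_apply, LinearMap.id_apply] at h1
  simp only [LinearMap.sum_apply, LinearMap.comp_apply, h2, h1]

lemma IsArtinAlgebra.endOp (h : IsArtinAlgebra Λ) (X : Type u) [AddCommGroup X]
    [Module Λ X] [Module.Finite Λ X] : IsArtinAlgebra (EndOp Λ X) := by
  obtain ⟨R, _, _, _, _⟩ := h
  let := Module.compHom X (algebraMap R Λ)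
  have : IsScalarTower R Λ X := isScalarTower_compHom R X
  have : Module.Finite R (X →ₗ[Λ] X) := finite_hom
  exact ⟨R, _, inferInstance, ‹_›, Module.Finite.equiv (MulOpposite.opLinearEquiv R)⟩

/-- A finite algebra over an artinian ring `R` in any universe is finite over the image of `R`,
which is a ring in the universe required by `IsArtinAlgebra`. -/
lemma isArtinAlgebra_of_finite (R : Type v) [CommRing R] [IsArtinianRing R] [Algebra R Λ]
    [Module.Finite R Λ] : IsArtinAlgebra Λ := by
  let S := (algebraMap R Λ).range
  have : ∀ x y : S, x * y = y * x := by
    rintro ⟨_, a, rfl⟩ ⟨_, b, rfl⟩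
    exact Subtype.ext (Algebra.commutes a _)
  let : CommRing S := { (inferInstance : Ring S) with mul_comm := this }
  let : Algebra S Λ :=
    { algebraMap := S.subtype
      smul := fun s x => s * x
      commutes' := by rintro ⟨_, a, rfl⟩ x; exact Algebra.commutes a x
      smul_def' := fun _ _ => rfl }
  refine ⟨S, ‹_›, ‹_›, ?_, ?_⟩
  · exact (algebraMap R Λ).rangeRestrict_surjective.isArtinianRing
  · obtain ⟨G, hG⟩ := Module.Finite.fg_top (R := R) (M := Λ)
    refine ⟨G, eq_top_iff.2 fun x _ => ?_⟩
    have hx : x ∈ Submodule.span R (G : Set Λ) := hG ▸ trivial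
    induction hx using Submodule.span_induction with
    | mem y hy => exact Submodule.subset_span hy
    | zero => exact zero_mem _
    | add y z _ _ hy hz => exact add_mem (hy trivial) (hz trivial)
    | smul r y _ hy =>
      rw [Algebra.smul_def]
      exact Submodule.smul_mem _ (⟨algebraMap R Λ r, r, rfl⟩ : S) (hy trivial)

end ArtinAlgebra

/-! ### Endomorphism algebras of cluster-tilting modules are Auslander algebras -/

section Dimensions

variable {Γ : Type u} [Ring Γ]

lemma globalDimension_le_iff (d : ℕ) : globalDimension Γ ≤ ((d + 1 : ℕ) : WithBot ℕ∞) ↔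
    ∀ (M : Type u) [AddCommGroup M] [Module Γ M], Module.Finite Γ M → PdLT Γ M (d + 2) := by
  constructor
  · intro h M _ _ hM
    exact (projectiveDimension_le_iff _ _).1
      ((le_iSup₂_of_le (f := fun (M : ModuleCat.{u} Γ)
        (_ : M ∈ {M : ModuleCat.{u} Γ | Module.Finite Γ M}) => projectiveDimension M)
        (ModuleCat.of Γ M) hM le_rfl).trans h)
  · intro h
    exact iSup₂_le fun M hM => (projectiveDimension_le_iff _ _).2 (h M hM)

end Dimensions

section ClusterTilting

/-- Cluster tilting for an unbundled module over an Artin algebra, where the approximations exist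
automatically and the vanishing conditions can be tested on `X` itself. -/
structure IsClusterTiltingModule (d : ℕ) (Λ X : Type u) [Ring Λ] [AddCommGroup X] [Module Λ X] :
    Prop where
  finite : Module.Finite Λ X
  mem_iff_right : ∀ (N : Type u) [AddCommGroup N] [Module Λ N], IsInAdd Λ X N ↔
    Module.Finite Λ N ∧ ∀ i, 0 < i → i < d → ExtVanishes Λ X N i
  mem_iff_left : ∀ (N : Type u) [AddCommGroup N] [Module Λ N], IsInAdd Λ X N ↔
    Module.Finite Λ N ∧ ∀ i, 0 < i → i < d → ExtVanishes Λ N X i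

variable {Λ : Type u} [Ring Λ] {d : ℕ}

/-- Over an Artin algebra `add X` is always functorially finite, so only the vanishing conditions
remain in the definition of a cluster tilting module. -/
lemma isClusterTilting_iff (h : IsArtinAlgebra Λ) (X : ModuleCat.{u} Λ) :
    IsClusterTilting d X ↔ IsClusterTiltingModule d Λ X := by
  have hl : ∀ (N : ModuleCat.{u} Λ) (i : ℕ),
      (∀ Y, addClosure X Y → Subsingleton (Abelian.Ext N Y i)) ↔ ExtVanishes Λ N X i := fun N i =>
    ⟨fun h => h X ((addClosure_iff _ _).2 isInAdd_self),
      fun h Y hY => ((addClosure_iff _ _).1 hY).extVanishes_right h⟩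
  have hr : ∀ (N : ModuleCat.{u} Λ) (i : ℕ),
      (∀ Y, addClosure X Y → Subsingleton (Abelian.Ext Y N i)) ↔ ExtVanishes Λ X N i := fun N i =>
    ⟨fun h => h X ((addClosure_iff _ _).2 isInAdd_self),
      fun h Y hY => ((addClosure_iff _ _).1 hY).extVanishes_left h⟩
  constructor
  · intro hX
    refine ⟨hX.fg X ((addClosure_iff _ _).2 isInAdd_self), fun N _ _ => ?_, fun N _ _ => ?_⟩
    · have := hX.mem_iff_right (ModuleCat.of Λ N)
      simp only [hr] at this
      rwa [addClosure_iff] at this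
    · have := hX.mem_iff_left (ModuleCat.of Λ N)
      simp only [hl] at this
      rwa [addClosure_iff] at this
  · intro hX
    have := hX.finite
    refine ⟨fun Y hY => ((addClosure_iff _ _).1 hY).finite, fun M hM => ?_, fun M hM => ?_,
      fun N => ?_, fun N => ?_⟩
    · obtain ⟨n, f, hf⟩ := h.exists_right_approx X M
      refine ⟨ModuleCat.of Λ (Fin n → X), ModuleCat.ofHom f,
        (addClosure_iff _ _).2 (.pi (LinearEquiv.refl Λ (Fin n → X)) fun _ => isInAdd_self),
        fun Y hY g => ?_⟩
      obtain ⟨k, hk⟩ := hf Y ((addClosure_iff _ _).1 hY) g.hom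
      exact ⟨ModuleCat.ofHom k, ModuleCat.hom_ext hk⟩
    · obtain ⟨n, f, hf⟩ := h.exists_left_approx X M
      refine ⟨ModuleCat.of Λ (Fin n → X), ModuleCat.ofHom f,
        (addClosure_iff _ _).2 (.pi (LinearEquiv.refl Λ (Fin n → X)) fun _ => isInAdd_self),
        fun Y hY g => ?_⟩
      obtain ⟨k, hk⟩ := hf Y ((addClosure_iff _ _).1 hY) g.hom
      exact ⟨ModuleCat.ofHom k, ModuleCat.hom_ext hk⟩
    · simp only [hr]
      rw [addClosure_iff]
      exact hX.mem_iff_right N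
    · simp only [hl]
      rw [addClosure_iff]
      exact hX.mem_iff_left N

namespace IsClusterTiltingModule

variable {X : Type u} [AddCommGroup X] [Module Λ X] (hX : IsClusterTiltingModule d Λ X)
include hX

lemma extVanishes_self {i : ℕ} (h0 : 0 < i) (hi : i < d) : ExtVanishes Λ X X i :=
  ((hX.mem_iff_right X).1 isInAdd_self).2 i h0 hi

lemma isInAdd_ring : IsInAdd Λ X Λ :=
  (hX.mem_iff_left Λ).2 ⟨inferInstance, fun i hi _ => extVanishes_of_projective i hi⟩

lemma isInAdd_of_injective (I : Type u) [AddCommGroup I] [Module Λ I] [Module.Finite Λ I]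
    [Module.Injective Λ I] : IsInAdd Λ X I :=
  (hX.mem_iff_right I).2 ⟨inferInstance, fun i hi _ => extVanishes_of_injective i hi⟩

lemma projInj_hom (I : Type u) [AddCommGroup I] [Module Λ I] [Module.Finite Λ I]
    [Module.Injective Λ I] : projInj (EndOp Λ X) (ModuleCat.of (EndOp Λ X) (X →ₗ[Λ] I)) :=
  have := hX.finite
  ⟨injective_hom (separates_of_isInAdd hX.isInAdd_ring),
    (hX.isInAdd_of_injective I).hom_self.projective⟩

/-- The image under `Hom(X, -)` of an injective coresolution of `Y` stays exact as far as the
extensions of `Y` by `X` vanish, and its terms are projective-injective. -/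
lemma hasCoresolution_hom (hΛ : IsArtinAlgebra Λ) (m : ℕ) (Y : Type u) [AddCommGroup Y]
    [Module Λ Y] [Module.Finite Λ Y] (h : ∀ j, 0 < j → j ≤ m → ExtVanishes Λ X Y j) :
    HasCoresolution (projInj (EndOp Λ X)) (m + 2) (ModuleCat.of _ (X →ₗ[Λ] Y)) := by
  induction m generalizing Y with
  | zero =>
    obtain ⟨I, f, _, _, hf⟩ := hΛ.exists_finite_injective Y
    obtain ⟨I', f', _, _, hf'⟩ := hΛ.exists_finite_injective (I ⧸ LinearMap.range f)
    let φ := homMap X (f' ∘ₗ (LinearMap.range f).mkQ)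
    have hex : Function.Exact f (f' ∘ₗ (LinearMap.range f).mkQ) := fun x => by
      rw [LinearMap.comp_apply, map_eq_zero_iff _ hf']
      exact Submodule.Quotient.mk_eq_zero _
    refine ⟨ModuleCat.of _ (X →ₗ[Λ] I), ModuleCat.of _ (LinearMap.range φ), homMap X f,
      φ.rangeRestrict, hX.projInj_hom I, homMap_injective hf, φ.surjective_rangeRestrict, ?_,
      ModuleCat.of _ (X →ₗ[Λ] I'), ModuleCat.of _ ((X →ₗ[Λ] I') ⧸ LinearMap.range φ),
      (LinearMap.range φ).subtype, (LinearMap.range φ).mkQ, hX.projInj_hom I',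
      Submodule.injective_subtype _, Submodule.mkQ_surjective _,
      LinearMap.exact_subtype_mkQ _, trivial⟩
    intro y
    refine Iff.trans ?_ (homMap_exact hf hex y)
    exact Subtype.ext_iff
  | succ m ih =>
    obtain ⟨I, f, _, _, hf⟩ := hΛ.exists_finite_injective Y
    have hex : Function.Exact f (LinearMap.range f).mkQ := LinearMap.exact_map_mkQ_range f
    have hs := (LinearMap.range f).mkQ_surjective
    refine ⟨ModuleCat.of _ (X →ₗ[Λ] I), ModuleCat.of _ (X →ₗ[Λ] (I ⧸ LinearMap.range f)),
      homMap X f, homMap X (LinearMap.range f).mkQ, hX.projInj_hom I, homMap_injective hf,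
      (h 1 one_pos (by omega)).exists_lift hf hs hex, homMap_exact hf hex, ih _ fun j h0 hj => ?_⟩
    exact (extVanishes_of_injective j h0).right_of_shortExact hf hs hex (h (j + 1) (by omega)
      (by omega))

/-- Resolving `K` by right `add X`-approximations, the syzygies acquire one more vanishing `Ext`
group in each step, until they lie in `add X`. -/
lemma pdLT_hom (hΛ : IsArtinAlgebra Λ) (k : ℕ) (K : Type u) [AddCommGroup K]
    [Module Λ K] [Module.Finite Λ K] (h : ∀ j, 0 < j → j + k < d → ExtVanishes Λ X K j) :
    PdLT (EndOp Λ X) (X →ₗ[Λ] K) (k + 1) := by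
  induction k generalizing K with
  | zero =>
    have : IsInAdd Λ X K := (hX.mem_iff_right K).2 ⟨inferInstance, fun i => h i⟩
    exact pdLT_one_iff.2 this.hom_self.projective
  | succ k ih =>
    have := hX.finite
    have := hΛ.isNoetherianRing
    obtain ⟨n, f, hf⟩ := hΛ.exists_right_approx X K
    have hXn : IsInAdd Λ X (Fin n → X) :=
      .pi (LinearEquiv.refl Λ (Fin n → X)) fun _ => isInAdd_self
    have hi := (LinearMap.ker f).injective_subtype
    have hex : Function.Exact (LinearMap.ker f).subtype f := LinearMap.exact_subtype_ker_map f
    -- `X` generates, so an `add X`-approximation is surjective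
    have hs : Function.Surjective f := fun x => by
      obtain ⟨k, hk⟩ := hf (ModuleCat.of Λ Λ) hX.isInAdd_ring (LinearMap.toSpanSingleton Λ K x)
      exact ⟨k (1 : Λ), (LinearMap.congr_fun hk (1 : Λ)).trans (one_smul Λ x)⟩
    have hlift := hf (ModuleCat.of Λ X) isInAdd_self
    have hK' := ih (LinearMap.ker f) fun j h0 hj => by
      have hXX : ∀ j, 0 < j → j < d → ExtVanishes Λ X (Fin n → X) j := fun j h0 hj =>
        hXn.extVanishes_right (hX.extVanishes_self h0 hj)
      obtain _ | _ | j := j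
      · omega
      · exact extVanishes_one_of_lift hi hs hex (hXX 1 one_pos (by omega)) hlift
      · exact (h (j + 1) (by omega) (by omega)).left_of_shortExact hi hs hex
          (hXX _ (by omega) (by omega))
    have : Module.Projective (EndOp Λ X) (X →ₗ[Λ] (Fin n → X)) := hXn.hom_self.projective
    exact hK'.right_of_shortExact (g := homMap X f) (homMap_injective hi) hlift
      (homMap_exact hi hex)
      (pdLT_succ_of_projective _)

/-- The second syzygy of a finitely generated module over `EndOp Λ X` has the form `Hom(X, K)`, and
`Hom(X, K)` has projective dimension less than `d`. -/
lemma pdLT_of_finite (hd : 1 ≤ d) (hΛ : IsArtinAlgebra Λ) (Z : Type u) [AddCommGroup Z]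
    [Module (EndOp Λ X) Z] [Module.Finite (EndOp Λ X) Z] : PdLT (EndOp Λ X) Z (d + 2) := by
  have := hX.finite
  have := hΛ.isNoetherianRing
  have := (hΛ.endOp X).isNoetherianRing
  have hadd : ∀ n, IsInAdd Λ X (Fin n → X) := fun n =>
    .pi (LinearEquiv.refl Λ (Fin n → X)) fun _ => isInAdd_self
  have key : ∀ (Z : Type u) [AddCommGroup Z] [Module (EndOp Λ X) Z] [Module.Finite (EndOp Λ X) Z],
      ∃ (n : ℕ) (a : (X →ₗ[Λ] (Fin n → X)) →ₗ[EndOp Λ X] Z), Function.Surjective a := by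
    intro Z _ _ _
    obtain ⟨n, s, hs⟩ := Module.Finite.exists_fin' (EndOp Λ X) Z
    let e : (X →ₗ[Λ] (Fin n → X)) →ₗ[EndOp Λ X] (Fin n → EndOp Λ X) :=
      LinearMap.pi fun i => (homSelfEquiv Λ X).toLinearMap ∘ₗ homMap X (LinearMap.proj i)
    refine ⟨n, s ∘ₗ e, hs.comp fun b => ⟨LinearMap.pi fun i => (b i).unop, ?_⟩⟩
    rfl
  obtain ⟨n, b, hb⟩ := key Z
  have : Module.Finite (EndOp Λ X) (X →ₗ[Λ] (Fin n → X)) := (hadd n).hom_self.finite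
  have : IsNoetherian (EndOp Λ X) (X →ₗ[Λ] (Fin n → X)) :=
    isNoetherian_of_isNoetherianRing_of_finite _ _
  obtain ⟨m, a, ha⟩ := key (LinearMap.ker b)
  have h1 : Module.Projective (EndOp Λ X) (X →ₗ[Λ] (Fin n → X)) := (hadd n).hom_self.projective
  have h2 : Module.Projective (EndOp Λ X) (X →ₗ[Λ] (Fin m → X)) := (hadd m).hom_self.projective
  obtain ⟨ψ, hψ⟩ := (hadd m).exists_homMap_eq ((LinearMap.ker b).subtype ∘ₗ a)
  have hi := (LinearMap.ker ψ).injective_subtype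
  have hex : Function.Exact (LinearMap.ker ψ).subtype ψ := LinearMap.exact_subtype_ker_map ψ
  have h3 : PdLT (EndOp Λ X) (X →ₗ[Λ] LinearMap.ker ψ) d := by
    obtain ⟨d, rfl⟩ := Nat.exists_eq_add_of_le' hd
    exact hX.pdLT_hom hΛ d _ fun j _ _ => by omega
  have h4 : PdLT (EndOp Λ X) (LinearMap.ker b) (d + 1) := by
    refine h3.right_of_shortExact (homMap_injective hi) ha (fun x => ?_)
      (pdLT_succ_of_projective d)
    refine Iff.trans ?_ (homMap_exact hi hex x)
    rw [hψ]
    exact Subtype.ext_iff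
  exact h4.right_of_shortExact (Submodule.injective_subtype _) hb
    (LinearMap.exact_subtype_ker_map b) (pdLT_succ_of_projective _)

lemma isAuslander_endOp (hd : 1 ≤ d) (hΛ : IsArtinAlgebra Λ) : IsAuslander (EndOp Λ X) d := by
  refine ⟨?_, (globalDimension_le_iff d).2 fun M _ _ _ => hX.pdLT_of_finite hd hΛ M⟩
  have := hX.finite
  obtain ⟨d, rfl⟩ := Nat.exists_eq_add_of_le' hd
  refine le_dominantDimension_of_hasCoresolution ((hX.hasCoresolution_hom hΛ d X
    fun j h0 hj => hX.extVanishes_self h0 (by omega)).of_linearEquiv (homSelfEquiv Λ X))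

end IsClusterTiltingModule

end ClusterTilting

/-! ### The torsion theory of an injective module -/

section Torsion

variable {Γ : Type u} [Ring Γ] {Q Z Z' : Type u} [AddCommGroup Q] [Module Γ Q] [AddCommGroup Z]
  [Module Γ Z] [AddCommGroup Z'] [Module Γ Z']

/-- `Z` is `Q`-torsion if there are no nonzero maps from `Z` to `Q`. For `Q` injective, the torsion
modules are closed under submodules, quotients and extensions. -/
def IsTorsionFor (Γ Q Z : Type u) [Ring Γ] [AddCommGroup Q] [Module Γ Q] [AddCommGroup Z]
    [Module Γ Z] : Prop :=
  ∀ f : Z →ₗ[Γ] Q, f = 0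

lemma IsTorsionFor.of_injective [Module.Injective Γ Q] (h : IsTorsionFor Γ Q Z)
    (i : Z' →ₗ[Γ] Z) (hi : Function.Injective i) : IsTorsionFor Γ Q Z' := fun f => by
  obtain ⟨g, rfl⟩ := Module.Injective.extension_property Γ Q Z' Z i hi f
  rw [h g, LinearMap.zero_comp]

lemma IsTorsionFor.of_surjective (h : IsTorsionFor Γ Q Z)
    (p : Z →ₗ[Γ] Z') (hp : Function.Surjective p) : IsTorsionFor Γ Q Z' := fun f => by
  ext z
  obtain ⟨z, rfl⟩ := hp z
  exact LinearMap.congr_fun (h (f ∘ₗ p)) z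

lemma IsTorsionFor.prod (h : IsTorsionFor Γ Q Z) (h' : IsTorsionFor Γ Q Z') :
    IsTorsionFor Γ Q (Z × Z') := fun _ =>
  LinearMap.prod_ext (h _) (h' _)

/-- Over an artinian ring there is a smallest left ideal with torsion quotient; it annihilates
all torsion modules. -/
lemma exists_ideal_torsion [IsArtinianRing Γ] [Module.Injective Γ Q] :
    ∃ L : Ideal Γ, IsTorsionFor Γ Q (Γ ⧸ L) ∧
      ∀ (Z : Type u) [AddCommGroup Z] [Module Γ Z], IsTorsionFor Γ Q Z →
        ∀ l ∈ L, ∀ z : Z, l • z = 0 := by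
  obtain ⟨L, hL, hmin⟩ := IsArtinian.set_has_minimal (R := Γ) (M := Γ)
    {L : Ideal Γ | IsTorsionFor Γ Q (Γ ⧸ L)} ⟨⊤, fun f => by
      ext
      have h1 : (1 : Γ) ∈ (⊤ : Ideal Γ) := trivial
      have : (⊤ : Ideal Γ).mkQ 1 = 0 := (Submodule.Quotient.mk_eq_zero _).2 h1
      change f ((⊤ : Ideal Γ).mkQ 1) = 0
      rw [this, map_zero]⟩
  refine ⟨L, hL, fun Z _ _ hZ l hl z => ?_⟩
  let L' : Ideal Γ := LinearMap.ker (LinearMap.toSpanSingleton Γ Z z)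
  have hL' : IsTorsionFor Γ Q (Γ ⧸ L') := hZ.of_injective (L'.liftQ _ le_rfl)
    (LinearMap.ker_eq_bot.1 (Submodule.ker_liftQ_eq_bot _ _ _ le_rfl))
  have hinf : IsTorsionFor Γ Q (Γ ⧸ (L ⊓ L')) := by
    refine (hL.prod hL').of_injective
      ((L ⊓ L').liftQ (L.mkQ.prod L'.mkQ) fun x hx => ?_) ?_
    · simpa [Submodule.Quotient.mk_eq_zero] using hx
    · refine LinearMap.ker_eq_bot.1 (Submodule.ker_liftQ_eq_bot _ _ _ fun x hx => ?_)
      simpa [Submodule.Quotient.mk_eq_zero] using hx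
  have : L ⊓ L' = L := by
    by_contra hne
    exact hmin _ hinf (lt_of_le_of_ne inf_le_left hne)
  have hl' : l ∈ L ⊓ L' := by rw [this]; exact hl
  exact hl'.2

/-- Modulo the radical, every left ideal of an artinian ring is generated by an idempotent of the
ring. -/
lemma exists_idempotent_of_ideal [IsArtinianRing Γ] (L : Ideal Γ) :
    ∃ e : Γ, IsIdempotentElem e ∧ (∃ l ∈ L, e - l ∈ Ring.jacobson Γ) ∧
      ∀ l ∈ L, ∃ c, l - c * e ∈ Ring.jacobson Γ := by
  let π := Ideal.Quotient.mk (Ring.jacobson Γ)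
  have hπ : Function.Surjective π := Ideal.Quotient.mk_surjective
  obtain ⟨n, hn⟩ := IsSemiprimaryRing.isNilpotent (R := Γ)
  obtain ⟨e', he', hL⟩ := IsSemisimpleRing.ideal_eq_span_idempotent (L.map π)
  obtain ⟨e, he, rfl⟩ := exists_isIdempotentElem_eq_of_ker_isNilpotent π (fun x hx => by
    have hx' : x ∈ Ring.jacobson Γ := Ideal.Quotient.eq_zero_iff_mem.1 hx
    refine ⟨n, ?_⟩
    have := Ideal.pow_mem_pow hx' n
    rwa [hn] at this) e' (hπ e') he'
  refine ⟨e, he, ?_, fun l hl => ?_⟩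
  · have : π e ∈ L.map π := hL ▸ Ideal.subset_span rfl
    obtain ⟨l, hl, hle⟩ := (Ideal.mem_map_iff_of_surjective π hπ).1 this
    exact ⟨l, hl, Ideal.Quotient.eq.1 hle.symm⟩
  · have : π l ∈ Ideal.span {π e} := hL ▸ Ideal.mem_map_of_mem π hl
    obtain ⟨c, hc⟩ := Ideal.mem_span_singleton'.1 this
    obtain ⟨c, rfl⟩ := hπ c
    exact ⟨c, Ideal.Quotient.eq.1 (by simpa using hc.symm)⟩

/-- Some idempotent `e` annihilates all `Q`-torsion modules, but no nonzero submodule of `Q`. It is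
obtained by lifting a generator of the image, modulo the radical, of the smallest left ideal with
torsion quotient. -/
lemma exists_idempotent_torsion [IsArtinianRing Γ] [Module.Injective Γ Q] [Module.Finite Γ Q] :
    ∃ e : Γ, IsIdempotentElem e ∧
      (∀ (Z : Type u) [AddCommGroup Z] [Module Γ Z], IsTorsionFor Γ Q Z → ∀ z : Z, e • z = 0) ∧
      ∀ Z : Submodule Γ Q, (∀ z ∈ Z, e • z = 0) → Z = ⊥ := by
  obtain ⟨L, hL, hLZ⟩ := exists_ideal_torsion (Γ := Γ) (Q := Q)
  obtain ⟨e, he, ⟨l, hl, hj⟩, hLe⟩ := exists_idempotent_of_ideal L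
  refine ⟨e, he, fun Z _ _ hZ z => ?_, fun Z hZ => ?_⟩
  · -- on torsion modules the idempotent `e` acts as the nilpotent element `e - l`
    obtain ⟨n, hn⟩ := IsSemiprimaryRing.isNilpotent (R := Γ)
    have hej : ∀ z : Z, e • z = (e - l) • z := fun z => by
      rw [sub_smul, hLZ Z hZ l hl, sub_zero]
    have hpow : ∀ n : ℕ, e ^ n • z = (e - l) ^ n • z := by
      intro n
      induction n with
      | zero => simp
      | succ n ih => rw [pow_succ', pow_succ', mul_smul, mul_smul, ih, hej]
    have hzero : (e - l) ^ n = 0 := by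
      have := Ideal.pow_mem_pow hj n
      rwa [hn] at this
    rw [← he.pow_succ_eq n, hpow, pow_succ', hzero, mul_zero, zero_smul]
  · by_contra hne
    have : IsArtinian Γ Q := inferInstance
    have hat : IsAtomic (Submodule Γ Q) := isAtomic_of_orderBot_wellFounded_lt
      (IsWellFounded.wf)
    obtain ⟨S, hS, hSZ⟩ := (hat.eq_bot_or_exists_atom_le Z).resolve_left hne
    have hsimple : IsSimpleModule Γ S := isSimpleModule_iff_isAtom.2 hS
    have hJS : ∀ j ∈ Ring.jacobson Γ, ∀ s : S, j • s = 0 := fun j hj =>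
      Module.mem_annihilator.1 (IsSemisimpleModule.jacobson_le_annihilator Γ S hj)
    have hLS : ∀ l ∈ L, ∀ s : S, l • s = 0 := fun l hl s => by
      obtain ⟨c, hc⟩ := hLe l hl
      have h1 : e • s = 0 := Subtype.ext (hZ s (hSZ s.2))
      have h2 := hJS _ hc s
      rwa [sub_smul, mul_smul, h1, smul_zero, sub_zero] at h2
    have htors : IsTorsionFor Γ Q S := by
      have : Nontrivial S := IsSimpleModule.nontrivial Γ S
      obtain ⟨s, hs⟩ := exists_ne (0 : S)
      refine hL.of_surjective (L.liftQ (LinearMap.toSpanSingleton Γ S s) fun l hl => ?_) ?_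
      · exact hLS l hl s
      · have h3 := IsSimpleModule.toSpanSingleton_surjective Γ hs
        intro x
        obtain ⟨a, rfl⟩ := h3 x
        exact ⟨L.mkQ a, rfl⟩
    have h0 := htors S.subtype
    refine hS.1 ?_
    rw [← Submodule.range_subtype S, h0, LinearMap.range_zero]

/-- For a finitely generated injective module `Q` over an artinian ring there is a finitely
generated projective module `P` such that `P` maps trivially to every `Q`-torsion module and
nontrivially to every nonzero submodule of `Q`: the projective cover of the socle of `Q`. -/
lemma exists_projective_torsion [IsArtinianRing Γ] [Module.Injective Γ Q] [Module.Finite Γ Q] :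
    ∃ P : ModuleCat.{u} Γ, Module.Finite Γ P ∧ Module.Projective Γ P ∧ Separates Γ P Q ∧
      ∀ (Z : Type u) [AddCommGroup Z] [Module Γ Z], IsTorsionFor Γ Q Z →
        ∀ s : P →ₗ[Γ] Z, s = 0 := by
  obtain ⟨e, he, h1, h2⟩ := exists_idempotent_torsion (Γ := Γ) (Q := Q)
  let P : Submodule Γ Γ := LinearMap.range (LinearMap.toSpanSingleton Γ Γ e)
  let r : Γ →ₗ[Γ] P := (LinearMap.toSpanSingleton Γ Γ e).rangeRestrict
  have hr : r ∘ₗ P.subtype = LinearMap.id := by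
    ext ⟨_, y, rfl⟩
    change y * e * e = y * e
    rw [mul_assoc, he.eq]
  let e' : P := ⟨e, 1, one_mul e⟩
  have hee' : e • e' = e' := Subtype.ext he
  have hP : ∀ p : P, ∃ y : Γ, p = y • e' := by
    rintro ⟨_, y, rfl⟩
    exact ⟨y, rfl⟩
  refine ⟨ModuleCat.of Γ P, ?_, ?_, ?_, fun Z _ _ hZ s => ?_⟩
  · exact Module.Finite.of_surjective r (LinearMap.surjective_rangeRestrict _)
  · exact Module.Projective.of_split P.subtype r hr
  · intro K _ _ g hg
    rw [← LinearMap.range_eq_bot]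
    refine h2 _ ?_
    rintro _ ⟨k, rfl⟩
    have := LinearMap.congr_fun (hg (LinearMap.toSpanSingleton Γ K k ∘ₗ P.subtype)) e'
    rw [← map_smul]
    exact this
  · ext p
    obtain ⟨y, rfl⟩ := hP p
    rw [map_smul, ← hee', map_smul, h1 Z hZ, smul_zero, LinearMap.zero_apply]

end Torsion

/-! ### Modules over the endomorphism ring of the detecting projective -/

section Cogenerator

variable {Γ : Type u} [Ring Γ] {P Q : Type u} [AddCommGroup P] [Module Γ P] [AddCommGroup Q]
  [Module Γ Q]

/-- Every nonzero element of a module over `EndOp Γ P` is detected by a map to `Hom(P, Q)`. -/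
lemma exists_hom_apply_ne_zero [Module.Finite Γ P] [Module.Projective Γ P] [Module.Injective Γ Q]
    (hsep : Separates Γ P Q)
    (htors : ∀ (Z : Type u) [AddCommGroup Z] [Module Γ Z], IsTorsionFor Γ Q Z →
      ∀ s : P →ₗ[Γ] Z, s = 0)
    {N : Type u} [AddCommGroup N] [Module (EndOp Γ P) N] (x : N) (hx : x ≠ 0) :
    ∃ θ : N →ₗ[EndOp Γ P] (P →ₗ[Γ] Q), θ x ≠ 0 := by
  let S : Submodule (EndOp Γ P) (P →ₗ[Γ] P) :=
    LinearMap.ker (LinearMap.toSpanSingleton (EndOp Γ P) N x ∘ₗ (homSelfEquiv Γ P).toLinearMap)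
  let W : Submodule Γ P := LinearMap.range (evalSum S.subtype)
  -- `W` is the image of `P` under the annihilator of `x`; if `P ⧸ W` were torsion, then `W = P` and
  -- projectivity of `P` would put the identity into that annihilator
  have hW : ¬ IsTorsionFor Γ Q (P ⧸ W) := fun h => by
    have h0 := htors _ h W.mkQ
    have hsurj : Function.Surjective (evalSum S.subtype) := by
      rw [← LinearMap.range_eq_top]
      change W = ⊤
      rw [← W.ker_mkQ, h0, LinearMap.ker_zero]
    obtain ⟨s, hs⟩ := Module.projective_lifting_property _ LinearMap.id hsurj
    obtain ⟨y, hy⟩ := exists_evalSum_comp_eq s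
    rw [hy] at hs
    have h1 : (MulOpposite.op (y : P →ₗ[Γ] P) : EndOp Γ P) • x = 0 := y.2
    rw [show (y : P →ₗ[Γ] P) = LinearMap.id from hs] at h1
    exact hx (by rwa [← one_smul (EndOp Γ P) x])
  simp only [IsTorsionFor, not_forall] at hW
  obtain ⟨f, hf⟩ := hW
  have := injective_hom hsep
  obtain ⟨θ, hθ⟩ := exists_comp_eq_of_ker_le (LinearMap.toSpanSingleton (EndOp Γ P) N x)
    (LinearMap.toSpanSingleton (EndOp Γ P) (P →ₗ[Γ] Q) (f ∘ₗ W.mkQ)) fun b hb => by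
      ext p
      have : W.mkQ (b.unop p) = 0 := (Submodule.Quotient.mk_eq_zero _).2
        ⟨Finsupp.single (⟨b.unop, hb⟩ : S) p, evalSum_single _ _ _⟩
      change f (W.mkQ (b.unop p)) = 0
      rw [this, map_zero]
  refine ⟨θ, fun h => hf ?_⟩
  have h1 := congrArg (fun l => l (1 : EndOp Γ P)) hθ
  simp only [LinearMap.comp_apply, LinearMap.toSpanSingleton_apply, one_smul, h] at h1
  refine LinearMap.ext fun y => ?_
  obtain ⟨p, rfl⟩ := W.mkQ_surjective y
  exact (congrArg (fun l => l p) h1).symm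

/-- For an artinian module, finitely many of the detecting maps have zero intersection of
kernels. -/
lemma exists_embedding_hom [Module.Finite Γ P] [Module.Projective Γ P] [Module.Injective Γ Q]
    (hsep : Separates Γ P Q)
    (htors : ∀ (Z : Type u) [AddCommGroup Z] [Module Γ Z], IsTorsionFor Γ Q Z →
      ∀ s : P →ₗ[Γ] Z, s = 0)
    (N : Type u) [AddCommGroup N] [Module (EndOp Γ P) N] [IsArtinian (EndOp Γ P) N] :
    ∃ (I : ModuleCat.{u} Γ) (θ : N →ₗ[EndOp Γ P] (P →ₗ[Γ] I)), IsInAdd Γ Q I ∧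
      Function.Injective θ := by
  classical
  obtain ⟨K, ⟨s, rfl⟩, hmin⟩ := IsArtinian.set_has_minimal (R := EndOp Γ P) (M := N)
    (Set.range fun s : Finset (N →ₗ[EndOp Γ P] (P →ₗ[Γ] Q)) => ⨅ θ ∈ s, LinearMap.ker θ)
    (Set.range_nonempty _)
  have h0 : ⨅ θ ∈ s, LinearMap.ker θ = ⊥ := by
    by_contra hne
    obtain ⟨x, hx, hx0⟩ := Submodule.exists_mem_ne_zero_of_ne_bot hne
    obtain ⟨θ, hθ⟩ := exists_hom_apply_ne_zero hsep htors x hx0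
    refine hmin _ ⟨insert θ s, rfl⟩ ?_
    simp only [Finset.iInf_insert]
    exact lt_of_le_of_ne inf_le_right fun h => hθ (by rw [← h] at hx; exact hx.1)
  let θ : N →ₗ[EndOp Γ P] (P →ₗ[Γ] (s → Q)) :=
    { toFun := fun x => LinearMap.pi fun i => i.1 x
      map_add' := fun x y => by ext; simp
      map_smul' := fun b x => by
        ext p i
        simp [homModule_smul_def] }
  refine ⟨ModuleCat.of Γ (s → Q), θ, .pi (LinearEquiv.refl Γ _) fun _ => isInAdd_self, ?_⟩
  rw [← LinearMap.ker_eq_bot, eq_bot_iff, ← h0]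
  intro x hx
  simp only [Submodule.mem_iInf]
  intro i hi
  ext p
  exact congrFun (LinearMap.congr_fun (show θ x = 0 from hx) p) ⟨i, hi⟩

end Cogenerator

/-- `Hom(P, M)` is generated over `EndOp Γ P` by the components of a right `add P`-approximation
of `M`. -/
lemma IsArtinAlgebra.finite_homModule {Γ : Type u} [Ring Γ] (hΓ : IsArtinAlgebra Γ) (P M : Type u)
    [AddCommGroup P] [Module Γ P] [AddCommGroup M] [Module Γ M] [Module.Finite Γ P]
    [Module.Finite Γ M] : Module.Finite (EndOp Γ P) (P →ₗ[Γ] M) := by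
  obtain ⟨n, f, hf⟩ := hΓ.exists_right_approx P M
  have h : IsInAdd Γ P (Fin n → P) := .pi (LinearEquiv.refl Γ _) fun _ => isInAdd_self
  have := (h.hom_self).finite
  exact Module.Finite.of_surjective (homMap P f) fun g => hf (ModuleCat.of Γ P) isInAdd_self g

lemma homMap_surjective {Γ : Type u} [Ring Γ] (P : Type u) {Y Z : Type u} [AddCommGroup P]
    [Module Γ P] [AddCommGroup Y] [Module Γ Y] [AddCommGroup Z] [Module Γ Z]
    [Module.Projective Γ P] {g : Y →ₗ[Γ] Z} (hg : Function.Surjective g) :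
    Function.Surjective (homMap P g) := fun φ =>
  Module.projective_lifting_property g φ hg

/-- The kernel of a map, as the start of a coresolution. -/
lemma hasCoresolution_ker {Γ : Type u} [Ring Γ] {𝒬 : ObjectProperty (ModuleCat.{u} Γ)}
    {I Y' : ModuleCat.{u} Γ} (ψ : I →ₗ[Γ] Y') (hI : 𝒬 I) {n : ℕ}
    (h : HasCoresolution 𝒬 n (ModuleCat.of Γ (LinearMap.range ψ))) :
    HasCoresolution 𝒬 (n + 1) (ModuleCat.of Γ (LinearMap.ker ψ)) :=
  ⟨I, _, (LinearMap.ker ψ).subtype, ψ.rangeRestrict, hI, Subtype.val_injective,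
    ψ.surjective_rangeRestrict, fun x => by
      simp [← Subtype.val_inj], h⟩

lemma hasCoresolution_one_of_injective {Γ : Type u} [Ring Γ] {𝒬 : ObjectProperty (ModuleCat.{u} Γ)}
    {I Y : ModuleCat.{u} Γ} (ψ : Y →ₗ[Γ] I) (hI : 𝒬 I) (hψ : Function.Injective ψ) :
    HasCoresolution 𝒬 1 Y :=
  ⟨I, ModuleCat.of Γ (I ⧸ LinearMap.range ψ), ψ, (LinearMap.range ψ).mkQ, hI, hψ,
    Submodule.mkQ_surjective _, fun x => by simp, trivial⟩

/-- The kernel of `Hom(P, ψ)` is `Hom(P, ker ψ)`. -/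
lemma nonempty_equiv_of_exact {Γ : Type u} [Ring Γ] {P Y Z N : Type u} [AddCommGroup P]
    [Module Γ P] [AddCommGroup Y] [Module Γ Y] [AddCommGroup Z] [Module Γ Z] [AddCommGroup N]
    [Module (EndOp Γ P) N] (ψ : Y →ₗ[Γ] Z) (θ : N →ₗ[EndOp Γ P] (P →ₗ[Γ] Y))
    (hθ : Function.Injective θ) (h : Function.Exact θ (homMap P ψ)) :
    Nonempty ((P →ₗ[Γ] LinearMap.ker ψ) ≃ₗ[EndOp Γ P] N) := by
  have hi : Function.Injective (LinearMap.ker ψ).subtype := Subtype.val_injective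
  have hex := homMap_exact (U := P) hi (LinearMap.exact_subtype_ker_map ψ)
  refine ⟨LinearEquiv.ofInjective _ (homMap_injective hi) ≪≫ₗ
    LinearEquiv.ofEq _ _ ?_ ≪≫ₗ (LinearEquiv.ofInjective θ hθ).symm⟩
  rw [← hex.linearMap_ker_eq, h.linearMap_ker_eq]

section Reconstruction

variable {Γ : Type u} [Ring Γ] {P Q : Type u} [AddCommGroup P] [Module Γ P] [AddCommGroup Q]
  [Module Γ Q]

/-- The situation in which `Γ` is recovered from a cluster tilting module over `EndOp Γ P`: the
first `d + 1` terms of a coresolution of `Γ` can be taken in `add Q` for a projective-injective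
module `Q`, and the projective module `P` detects maps into `Q` and maps trivially to `Q`-torsion
modules. The bound `d + 2` means projective dimension at most `d + 1`. -/
structure IsDetecting (d : ℕ) (Γ P Q : Type u) [Ring Γ] [AddCommGroup P] [Module Γ P]
    [AddCommGroup Q] [Module Γ Q] : Prop where
  artin : IsArtinAlgebra Γ
  finite_left : Module.Finite Γ P
  projective_left : Module.Projective Γ P
  finite_right : Module.Finite Γ Q
  injective_right : Module.Injective Γ Q
  projective_right : Module.Projective Γ Q
  separates : Separates Γ P Q
  torsion : ∀ (Z : Type u) [AddCommGroup Z] [Module Γ Z], IsTorsionFor Γ Q Z →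
      ∀ s : P →ₗ[Γ] Z, s = 0
  hasCoresolution : HasCoresolution (fun I => IsInAdd Γ Q I) (d + 1) (ModuleCat.of Γ Γ)
  pdLT : ∀ (M : Type u) [AddCommGroup M] [Module Γ M], Module.Finite Γ M → PdLT Γ M (d + 2)

namespace IsDetecting

variable {d : ℕ} (h : IsDetecting d Γ P Q)
include h

lemma injective_hom_of_isInAdd {I : Type u} [AddCommGroup I] [Module Γ I] (hI : IsInAdd Γ Q I) :
    Module.Injective (EndOp Γ P) (P →ₗ[Γ] I) :=
  have := h.finite_left
  have := h.injective_right
  have := hI.injective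
  injective_hom (h.separates.of_isInAdd hI)

lemma separates_of_hasCoresolution {Y : ModuleCat.{u} Γ} {n : ℕ}
    (hY : HasCoresolution (fun I => IsInAdd Γ Q I) (n + 1) Y) : Separates Γ P Y := by
  obtain ⟨I, C, f, g, hI, hf, -⟩ := hY
  exact (h.separates.of_isInAdd hI).of_injective hf

/-- `Hom(P, -)` is full on maps into modules with a copresentation in `add Q`. -/
lemma exists_homMap_eq {Y : ModuleCat.{u} Γ} {n : ℕ}
    (hY : HasCoresolution (fun I => IsInAdd Γ Q I) (n + 2) Y) {M : Type u} [AddCommGroup M]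
    [Module Γ M] (φ : (P →ₗ[Γ] M) →ₗ[EndOp Γ P] (P →ₗ[Γ] Y)) :
    ∃ ψ : M →ₗ[Γ] Y, homMap P ψ = φ := by
  have := h.finite_left
  have := h.injective_right
  obtain ⟨I, C, f, g, hI, hf, hg, hfg, hC⟩ := hY
  have := hI.injective
  obtain ⟨I', C', f', g', hI', hf', -⟩ := hC
  refine exists_homMap_eq_of_copresentation (h.separates.of_isInAdd hI)
    (h.separates.of_isInAdd hI') (g := f' ∘ₗ g) hf (fun x => ?_) φ
  rw [LinearMap.comp_apply, map_eq_zero_iff _ hf']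
  exact hfg x

lemma shortExact_homMap {K Y N : Type u} [AddCommGroup K] [Module Γ K] [AddCommGroup Y] [Module Γ Y]
    [AddCommGroup N] [Module Γ N] {f : K →ₗ[Γ] Y} {g : Y →ₗ[Γ] N} (hf : Function.Injective f)
    (hg : Function.Surjective g) (hfg : Function.Exact f g) :
    Function.Injective (homMap P f) ∧ Function.Surjective (homMap P g) ∧
      Function.Exact (homMap P f) (homMap P g) :=
  have := h.projective_left
  ⟨homMap_injective hf, homMap_surjective P hg, homMap_exact hf hfg⟩

/-- A coresolution of `Y` in `add Q` becomes an injective coresolution of `Hom(P, Y)`, on which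
`Hom(Hom(P, Γ), -)` is exact by full faithfulness. -/
lemma extVanishes_of_hasCoresolution (i : ℕ) (Y : ModuleCat.{u} Γ)
    (hY : HasCoresolution (fun I => IsInAdd Γ Q I) (i + 3) Y) :
    ExtVanishes (EndOp Γ P) (P →ₗ[Γ] Γ) (P →ₗ[Γ] Y) (i + 1) := by
  induction i generalizing Y with
  | zero =>
    obtain ⟨I, C, f, g, hI, hf, hg, hfg, hC⟩ := hY
    obtain ⟨hf', hg', hfg'⟩ := h.shortExact_homMap hf hg hfg
    have := h.injective_hom_of_isInAdd hI
    refine extVanishes_one_of_lift hf' hg' hfg' (extVanishes_of_injective 1 one_pos) fun φ => ?_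
    obtain ⟨ψ, rfl⟩ := h.exists_homMap_eq hC φ
    obtain ⟨ψ', rfl⟩ := Module.projective_lifting_property g ψ hg
    exact ⟨homMap P ψ', rfl⟩
  | succ i ih =>
    obtain ⟨I, C, f, g, hI, hf, hg, hfg, hC⟩ := hY
    obtain ⟨hf', hg', hfg'⟩ := h.shortExact_homMap hf hg hfg
    have := h.injective_hom_of_isInAdd hI
    exact (ih C hC).left_of_shortExact hf' hg' hfg' (extVanishes_of_injective _ (by omega))

/-- Finitely generated modules over `EndOp Γ P` come from `Γ`-modules copresented by `add Q`, and
the vanishing of extensions by `Hom(P, Γ)` bounds the projective dimension of these. -/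
lemma exists_equiv_hom (m : ℕ) (hm : m + 1 ≤ d) (N : Type u) [AddCommGroup N]
    [Module (EndOp Γ P) N] [Module.Finite (EndOp Γ P) N]
    (hN : ∀ j, 0 < j → j ≤ m → ExtVanishes (EndOp Γ P) (P →ₗ[Γ] Γ) N j) :
    ∃ Y : ModuleCat.{u} Γ, Module.Finite Γ Y ∧ HasCoresolution (fun I => IsInAdd Γ Q I) 2 Y ∧
      PdLT Γ Y (d - m) ∧ Nonempty ((P →ₗ[Γ] Y) ≃ₗ[EndOp Γ P] N) := by
  have := h.finite_left
  have := h.projective_left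
  have := h.finite_right
  have := h.injective_right
  have := h.projective_right
  have := h.artin.isNoetherianRing
  have := (h.artin.endOp P).isArtinianRing
  have := (h.artin.endOp P).isNoetherianRing
  induction m generalizing N with
  | zero =>
    obtain ⟨I, θ, hI, hθ⟩ := exists_embedding_hom h.separates h.torsion N
    have := hI.finite
    have := hI.injective
    have := hI.projective
    have := h.artin.finite_homModule P I
    obtain ⟨I', θ', hI', hθ'⟩ := exists_embedding_hom h.separates h.torsion
      ((P →ₗ[Γ] I) ⧸ LinearMap.range θ)
    have := hI'.finite
    have := hI'.injective
    have := hI'.projective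
    obtain ⟨ψ, hψ⟩ := exists_homMap_eq_of_injective (h.separates.of_isInAdd hI')
      (θ' ∘ₗ (LinearMap.range θ).mkQ)
    have hex : Function.Exact θ (homMap P ψ) := fun x => by
      rw [hψ, LinearMap.comp_apply, map_eq_zero_iff _ hθ']
      simp
    refine ⟨ModuleCat.of Γ (LinearMap.ker ψ), inferInstance, hasCoresolution_ker ψ hI
      (hasCoresolution_one_of_injective (LinearMap.range ψ).subtype hI' Subtype.val_injective), ?_,
      nonempty_equiv_of_exact ψ θ hθ hex⟩
    -- `ker ψ` is the second syzygy of the cokernel of `ψ`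
    have h1 : PdLT Γ (I' ⧸ LinearMap.range ψ) (d + 2) := h.pdLT _ inferInstance
    have h2 : PdLT Γ (LinearMap.range ψ) (d + 1) :=
      PdLT.left_of_shortExact (LinearMap.range ψ).injective_subtype
        (LinearMap.range ψ).mkQ_surjective (LinearMap.exact_subtype_mkQ _)
        (pdLT_succ_of_projective d) h1
    refine PdLT.left_of_shortExact (LinearMap.ker ψ).injective_subtype
        ψ.surjective_rangeRestrict (fun x => by simp [← Subtype.val_inj])
        ((pdLT_succ_of_projective 0).mono (by omega)) h2
  | succ m ih =>
    obtain ⟨I, θ, hI, hθ⟩ := exists_embedding_hom h.separates h.torsion N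
    have := hI.finite
    have := hI.injective
    have := hI.projective
    have := h.artin.finite_homModule P I
    have := h.injective_hom_of_isInAdd hI
    let π := (LinearMap.range θ).mkQ
    have hπ : Function.Surjective π := Submodule.mkQ_surjective _
    have hθπ : Function.Exact θ π := fun x => by simp [π]
    obtain ⟨Y', hY', hcY', hpY', ⟨e⟩⟩ := ih (by omega) ((P →ₗ[Γ] I) ⧸ LinearMap.range θ)
      fun j h0 hj => (extVanishes_of_injective j h0).right_of_shortExact hθ hπ hθπ
        (hN (j + 1) (by omega) (by omega))
    obtain ⟨ψ, hψ⟩ := h.exists_homMap_eq hcY' (e.symm.toLinearMap ∘ₗ π)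
    have hex : Function.Exact θ (homMap P ψ) := fun x => by
      rw [hψ, LinearMap.comp_apply, LinearEquiv.coe_coe, map_eq_zero_iff _ e.symm.injective]
      exact hθπ x
    -- the image of `ψ` is reached by all maps from `Γ`, because `Ext¹(Hom(P, Γ), N) = 0`
    have hsurj : Function.Surjective ψ := fun y => by
      obtain ⟨φ, hφ⟩ := (hN 1 one_pos (by omega)).exists_lift hθ hπ hθπ
        (e.toLinearMap ∘ₗ homMap P (LinearMap.toSpanSingleton Γ Y' y))
      obtain ⟨ψ', rfl⟩ := exists_homMap_eq_of_injective (h.separates.of_isInAdd hI) φ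
      have h1 : homMap P (ψ ∘ₗ ψ') = homMap P (LinearMap.toSpanSingleton Γ Y' y) := by
        rw [homMap_comp, hψ, LinearMap.comp_assoc, hφ, ← LinearMap.comp_assoc,
          LinearEquiv.symm_comp, LinearMap.id_comp]
      have h2 := (h.separates_of_hasCoresolution hcY').homMap_injective h1
      exact ⟨ψ' 1, by simpa using LinearMap.congr_fun h2 1⟩
    have hr : HasCoresolution (fun I => IsInAdd Γ Q I) 1 (ModuleCat.of Γ (LinearMap.range ψ)) :=
      (hcY'.of_le one_le_two).of_linearEquiv
        (LinearEquiv.ofTop _ (LinearMap.range_eq_top.2 hsurj)).symm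
    refine ⟨ModuleCat.of Γ (LinearMap.ker ψ), inferInstance, hasCoresolution_ker ψ hI hr, ?_,
      nonempty_equiv_of_exact ψ θ hθ hex⟩
    rw [show d - m = d - (m + 1) + 1 by omega] at hpY'
    exact PdLT.left_of_shortExact (LinearMap.ker ψ).injective_subtype hsurj
      (LinearMap.exact_subtype_ker_map ψ) ((pdLT_succ_of_projective 0).mono (by omega)) hpY'

/-- Dimension shifting along a projective resolution of `K`. -/
lemma extVanishes_hom_of_pdLT (N : Type u) [AddCommGroup N] [Module (EndOp Γ P) N]
    (hN : ∀ i, 0 < i → i < d → ExtVanishes (EndOp Γ P) N (P →ₗ[Γ] Γ) i)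
    (k : ℕ) (K : Type u) [AddCommGroup K] [Module Γ K] [Module.Finite Γ K] (hK : PdLT Γ K (k + 1))
    (j : ℕ) (h0 : 0 < j) (hj : j + k < d) :
    ExtVanishes (EndOp Γ P) N (P →ₗ[Γ] K) j := by
  have := h.artin.isNoetherianRing
  induction k generalizing K j with
  | zero =>
    have := pdLT_one_iff.1 hK
    exact (IsInAdd.of_projective.hom).extVanishes_right (hN j h0 hj)
  | succ k ih =>
    obtain ⟨n, π, hπ⟩ := Module.Finite.exists_fin' Γ K
    obtain ⟨hf', hg', hfg'⟩ := h.shortExact_homMap (LinearMap.ker π).injective_subtype hπ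
      (LinearMap.exact_subtype_ker_map π)
    have h1 : PdLT Γ (LinearMap.ker π) (k + 1) :=
      PdLT.left_of_shortExact (LinearMap.ker π).injective_subtype hπ
        (LinearMap.exact_subtype_ker_map π) (pdLT_succ_of_projective k) hK
    refine ExtVanishes.right_of_shortExact hf' hg' hfg' ?_ (ih _ h1 (j + 1) (by omega) (by omega))
    exact (IsInAdd.of_projective.hom).extVanishes_right (hN j h0 (by omega))

/-- The module `Hom(P, Γ)` is `d`-cluster tilting over `EndOp Γ P`. -/
lemma isClusterTiltingModule (hd : 1 ≤ d) :
    IsClusterTiltingModule d (EndOp Γ P) (P →ₗ[Γ] Γ) := by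
  have := h.finite_left
  have := h.artin.isNoetherianRing
  have hfin := h.artin.finite_homModule P Γ
  have hself : ∀ i, 0 < i → i < d → ExtVanishes (EndOp Γ P) (P →ₗ[Γ] Γ) (P →ₗ[Γ] Γ) i := by
    intro i h0 hi
    obtain ⟨i, rfl⟩ := Nat.exists_eq_succ_of_ne_zero h0.ne'
    exact h.extVanishes_of_hasCoresolution i (ModuleCat.of Γ Γ)
      (h.hasCoresolution.of_le (by omega))
  refine ⟨hfin, fun N _ _ => ⟨fun hN => ⟨hN.finite, fun i h0 hi =>
    hN.extVanishes_right (hself i h0 hi)⟩, fun ⟨hN, hext⟩ => ?_⟩, fun N _ _ => ⟨fun hN =>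
    ⟨hN.finite, fun i h0 hi => hN.extVanishes_left (hself i h0 hi)⟩, fun ⟨hN, hext⟩ => ?_⟩⟩
  · obtain ⟨Y, hY, -, hpY, ⟨e⟩⟩ := h.exists_equiv_hom (d - 1) (by omega) N
      fun j h0 hj => hext j h0 (by omega)
    rw [show d - (d - 1) = 1 by omega, pdLT_one_iff] at hpY
    exact (IsInAdd.of_projective.hom).of_linearEquiv e
  · obtain ⟨Y, hY, -, hpY, ⟨e⟩⟩ := h.exists_equiv_hom 0 hd N fun j h0 hj => by omega
    obtain _ | _ | d := d
    · omega
    · rw [Nat.sub_zero, pdLT_one_iff] at hpY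
      exact (IsInAdd.of_projective.hom).of_linearEquiv e
    · obtain ⟨n, π, hπ⟩ := Module.Finite.exists_fin' Γ Y
      obtain ⟨hf', hg', hfg'⟩ := h.shortExact_homMap (LinearMap.ker π).injective_subtype hπ
        (LinearMap.exact_subtype_ker_map π)
      have h1 : PdLT Γ (LinearMap.ker π) (d + 1) :=
        PdLT.left_of_shortExact (LinearMap.ker π).injective_subtype hπ
          (LinearMap.exact_subtype_ker_map π) (pdLT_succ_of_projective d) hpY
      have h2 := h.extVanishes_hom_of_pdLT N hext d _ h1 1 one_pos (by omega)
      obtain ⟨ψ, hψ⟩ := h2.exists_lift hf' hg' hfg' e.symm.toLinearMap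
      refine IsInAdd.retract (N := P →ₗ[Γ] (Fin n → Γ)) IsInAdd.of_projective.hom ψ
        (e.toLinearMap ∘ₗ homMap P π) ?_
      rw [LinearMap.comp_assoc, hψ, LinearEquiv.comp_symm]

/-- Every `EndOp Γ P`-linear endomorphism of `Hom(P, Γ)` is composition with a unique right
multiplication of `Γ`. -/
lemma mulRight_bijective (hd : 1 ≤ d) : Function.Bijective fun γ : Γ =>
    (MulOpposite.op (homMap P (LinearMap.toSpanSingleton Γ Γ γ)) :
      EndOp (EndOp Γ P) (P →ₗ[Γ] Γ)) := by
  have hc : HasCoresolution (fun I => IsInAdd Γ Q I) 2 (ModuleCat.of Γ Γ) :=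
    h.hasCoresolution.of_le (by omega)
  refine ⟨fun γ γ' hγ => ?_, fun φ => ?_⟩
  · have h1 := (h.separates_of_hasCoresolution hc).homMap_injective (MulOpposite.op_injective hγ)
    simpa using LinearMap.congr_fun h1 1
  · obtain ⟨ψ, hψ⟩ := h.exists_homMap_eq hc φ.unop
    refine ⟨ψ 1, ?_⟩
    rw [← MulOpposite.op_unop φ, ← hψ]
    refine congrArg (fun l => MulOpposite.op (homMap P l)) ?_
    ext
    simp

end IsDetecting

end Reconstruction

/-! ### The projective-injective modules of an Auslander algebra -/

/-- A minimal injective resolution of `M₀`, cut off at a term `I k`, is a coresolution of the kernel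
of the differential out of `I k`. -/
lemma MinimalInjectiveResolution.hasCoresolution {Γ : Type u} [Ring Γ] {M₀ : ModuleCat.{u} Γ}
    (J : MinimalInjectiveResolution M₀) {𝒬 : ObjectProperty (ModuleCat.{u} Γ)} (n k : ℕ)
    (h𝒬 : ∀ i < n, 𝒬 (J.I (k + i))) (M : ModuleCat.{u} Γ) (j : M →ₗ[Γ] J.I k)
    (hj : Function.Injective j) (hex : Function.Exact j (J.δ k)) : HasCoresolution 𝒬 n M := by
  induction n generalizing k M with
  | zero => trivial
  | succ n ih =>
    refine ⟨J.I k, ModuleCat.of Γ (LinearMap.range (J.δ k)), j, (J.δ k).rangeRestrict,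
      h𝒬 0 (by omega), hj, (J.δ k).surjective_rangeRestrict, fun x => ?_,
      ih (k + 1) (fun i hi => ?_) _ (LinearMap.range (J.δ k)).subtype Subtype.val_injective
        fun x => ?_⟩
    · rw [← hex x, ← Subtype.val_inj]
      rfl
    · rw [show k + 1 + i = k + (i + 1) by omega]
      exact h𝒬 (i + 1) (by omega)
    · rw [J.exact_succ k x]
      simp

lemma MinimalInjectiveResolution.finite {Γ : Type u} [Ring Γ] (hΓ : IsArtinAlgebra Γ)
    {M : ModuleCat.{u} Γ} [Module.Finite Γ M] (J : MinimalInjectiveResolution M) (n : ℕ) :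
    Module.Finite Γ (J.I n) := by
  induction n with
  | zero => exact hΓ.finite_of_isEssential J.ι J.ι_injective J.essential_zero
  | succ n ih =>
    exact hΓ.finite_of_isEssential (LinearMap.range (J.δ n)).subtype Subtype.val_injective
      (by rw [Submodule.range_subtype]; exact J.essential_succ n)

/-- For a `d`-Auslander algebra, `Q` is the sum of the first `d + 1` terms of a minimal injective
resolution. -/
lemma exists_isDetecting {Γ : Type u} [Ring Γ] (hΓ : IsArtinAlgebra Γ) {d : ℕ}
    (h : IsAuslander Γ d) : ∃ P Q : ModuleCat.{u} Γ, IsDetecting d Γ P Q := by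
  obtain ⟨J, hJ⟩ := exists_of_le_dominantDimension h.1
  have hinj := J.injective
  have hfin : ∀ i, Module.Finite Γ (J.I i) := J.finite hΓ
  have := hΓ.isArtinianRing
  let Q := ∀ i : Fin (d + 1), J.I i
  have hproj : ∀ i : Fin (d + 1), Module.Projective Γ (J.I i) := fun i => hJ i i.2
  have hQ : Module.Projective Γ Q :=
    Module.Projective.of_equiv DFinsupp.linearEquivFunOnFintype
  have hQ' : Module.Injective Γ Q := inferInstance
  have hQf : Module.Finite Γ Q := inferInstance
  obtain ⟨P, h1, h2, h3, h4⟩ := exists_projective_torsion (Γ := Γ) (Q := Q)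
  refine ⟨P, ModuleCat.of Γ Q, ⟨hΓ, h1, h2, hQf, hQ', hQ, h3, h4, ?_,
    (globalDimension_le_iff d).1 h.2⟩⟩
  refine J.hasCoresolution (d + 1) 0 (fun i hi => ?_) _ J.ι J.ι_injective J.exact_zero
  rw [zero_add]
  exact isInAdd_self.retract (LinearMap.single Γ (fun i : Fin (d + 1) => J.I i) ⟨i, hi⟩)
    (LinearMap.proj (⟨i, hi⟩ : Fin (d + 1))) (LinearMap.ext fun x => Pi.single_eq_same _ _)

/-! ### Morita theory -/

section Generator

variable {A : Type u} [Ring A] {U M N : Type u} [AddCommGroup U] [Module A U] [AddCommGroup M]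
  [Module A M] [AddCommGroup N] [Module A N]

/-- `Hom(U, -)` is full if `U` is a finitely generated generator. -/
lemma exists_homMap_eq_of_generator [Module.Finite A U] (h : IsInAdd A U A)
    (φ : (U →ₗ[A] M) →ₗ[EndOp A U] (U →ₗ[A] N)) : ∃ ψ : M →ₗ[A] N, homMap U ψ = φ := by
  have hker := evalSum_ker_le (S := ⊤) (φ ∘ₗ Submodule.subtype _) (separates_of_isInAdd h)
  have hsurj : Function.Surjective
      (evalSum (⊤ : Submodule (EndOp A U) (U →ₗ[A] M)).subtype) := by
    intro m
    obtain ⟨n, t, s, hst⟩ := h.exists_sum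
    refine ⟨∑ i, Finsupp.single ⟨LinearMap.toSpanSingleton A M m ∘ₗ s i, trivial⟩ (t i 1), ?_⟩
    rw [map_sum]
    simp only [evalSum_single]
    have := congrArg (fun l => (l 1) • m) hst
    simpa [LinearMap.sum_apply, Finset.sum_smul] using this
  let e := (evalSum (⊤ : Submodule (EndOp A U) (U →ₗ[A] M)).subtype).quotKerEquivOfSurjective hsurj
  refine ⟨(LinearMap.ker (evalSum (⊤ : Submodule (EndOp A U) (U →ₗ[A] M)).subtype)).liftQ
    (evalSum (φ ∘ₗ (⊤ : Submodule (EndOp A U) (U →ₗ[A] M)).subtype)) hker ∘ₗ e.symm.toLinearMap, ?_⟩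
  ext s u
  have hs : e.symm (s u) = (LinearMap.ker (evalSum (⊤ : Submodule (EndOp A U)
      (U →ₗ[A] M)).subtype)).mkQ (Finsupp.single ⟨s, trivial⟩ u) := by
    rw [LinearEquiv.symm_apply_eq]
    exact (evalSum_single (⊤ : Submodule (EndOp A U) (U →ₗ[A] M)).subtype ⟨s, trivial⟩ u).symm
  rw [homMap_apply, LinearMap.comp_apply, LinearMap.comp_apply, LinearEquiv.coe_coe, hs,
    Submodule.mkQ_apply, Submodule.liftQ_apply, evalSum_single]
  rfl

/-- `Hom(U, -)` turns direct sums of copies of the finitely generated module `U` into free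
modules. -/
lemma bijective_linearCombination_lsingle [Module.Finite A U] (S : Type u) :
    Function.Bijective (Finsupp.linearCombination (EndOp A U)
      fun i : S => (Finsupp.lsingle i : U →ₗ[A] (S →₀ U))) := by
  classical
  constructor
  · intro x y hxy
    ext i
    have h : ∀ x : S →₀ EndOp A U, Finsupp.lapply (R := A) i ∘ₗ
        Finsupp.linearCombination (EndOp A U)
          (fun i : S => (Finsupp.lsingle i : U →ₗ[A] (S →₀ U))) x = (x i).unop := by
      intro x
      induction x using Finsupp.induction_linear with
      | zero => simp
      | add x y hx hy => rw [map_add, LinearMap.comp_add, hx, hy]; rfl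
      | single j b =>
        rw [Finsupp.linearCombination_single, homModule_smul_def]
        ext u
        by_cases hij : j = i
        · subst hij; simp
        · simp [hij]
    exact MulOpposite.unop_injective (by rw [← h x, ← h y, hxy])
  · intro s
    obtain ⟨T, hT⟩ := exists_support_subset s
    refine ⟨∑ t ∈ T, Finsupp.single t (MulOpposite.op (Finsupp.lapply t ∘ₗ s)), ?_⟩
    rw [map_sum]
    simp only [Finsupp.linearCombination_single, op_smul_hom]
    ext1 u
    rw [LinearMap.sum_apply]
    conv_rhs => rw [← Finsupp.sum_single (s u), Finsupp.sum_of_support_subset _ (hT u) _ (by simp)]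
    rfl

/-- Every module over `EndOp A U` is of the form `Hom(U, M)`, if `U` is a progenerator. -/
lemma exists_linearEquiv_hom [Module.Finite A U] [Module.Projective A U] (h : IsInAdd A U A)
    (N : Type u) [AddCommGroup N] [Module (EndOp A U) N] :
    ∃ M : ModuleCat.{u} A, Nonempty ((U →ₗ[A] M) ≃ₗ[EndOp A U] N) := by
  -- every `N` has a presentation by modules `Hom(U, M)`, which lifts to a map of `A`-modules
  have hcover : ∀ (N : Type u) [AddCommGroup N] [Module (EndOp A U) N],
      ∃ a : (U →ₗ[A] (N →₀ U)) →ₗ[EndOp A U] N, Function.Surjective a := by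
    intro N _ _
    let e := LinearEquiv.ofBijective _ (bijective_linearCombination_lsingle (A := A) (U := U) N)
    refine ⟨Finsupp.linearCombination (EndOp A U) id ∘ₗ e.symm.toLinearMap, ?_⟩
    exact (Finsupp.linearCombination_id_surjective _ N).comp e.symm.surjective
  obtain ⟨a, ha⟩ := hcover N
  obtain ⟨b, hb⟩ := hcover (LinearMap.ker a)
  obtain ⟨ψ, hψ⟩ := exists_homMap_eq_of_generator h ((LinearMap.ker a).subtype ∘ₗ b)
  have hker : LinearMap.ker (homMap U (LinearMap.range ψ).mkQ) = LinearMap.ker a := by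
    have h1 : LinearMap.ker a = LinearMap.range (homMap U ψ) := by
      rw [hψ, LinearMap.range_comp, LinearMap.range_eq_top.2 hb, Submodule.map_top,
        Submodule.range_subtype]
    refine Eq.trans ?_ h1.symm
    ext s
    constructor
    · intro hs
      have hs' : ∀ u, s u ∈ LinearMap.range ψ := fun u =>
        (Submodule.Quotient.mk_eq_zero _).1 (LinearMap.congr_fun (show _ = _ from hs) u)
      obtain ⟨s', hs'⟩ := Module.projective_lifting_property ψ.rangeRestrict
        (s.codRestrict _ hs') ψ.surjective_rangeRestrict
      refine ⟨s', LinearMap.ext fun u => ?_⟩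
      exact congrArg Subtype.val (LinearMap.congr_fun hs' u)
    · rintro ⟨s', rfl⟩
      ext u
      exact (Submodule.Quotient.mk_eq_zero _).2 ⟨s' u, rfl⟩
  exact ⟨ModuleCat.of A (_ ⧸ LinearMap.range ψ),
    ⟨((homMap U (LinearMap.range ψ).mkQ).quotKerEquivOfSurjective
      (homMap_surjective U (Submodule.mkQ_surjective _))).symm ≪≫ₗ
      Submodule.quotEquivOfEq _ _ hker ≪≫ₗ a.quotKerEquivOfSurjective ha⟩⟩

/-- A module through which all maps are detected is a generator. -/
lemma isInAdd_of_separates (h : ∀ I : ModuleCat.{u} A, Separates A U I) : IsInAdd A U A := by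
  -- the image of `f` is the trace of `U` in `A`
  let f : ((U →ₗ[A] A) →₀ U) →ₗ[A] A := Finsupp.lsum ℕ id
  have h0 : (LinearMap.range f).mkQ = 0 :=
      h (ModuleCat.of A (A ⧸ LinearMap.range f)) A _ fun s => by
    ext u
    exact (Submodule.Quotient.mk_eq_zero _).2 ⟨Finsupp.single s u, by simp [f]⟩
  have h1 : (1 : A) ∈ LinearMap.range f := by
    rw [← Submodule.Quotient.mk_eq_zero]
    exact LinearMap.congr_fun h0 1
  obtain ⟨x, hx⟩ := h1
  refine .of_sum (ι := x.support) (fun i => LinearMap.toSpanSingleton A U (x i))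
    (fun i => i.1) ?_
  ext
  refine Eq.trans ?_ hx
  rw [LinearMap.sum_apply]
  simp [f, Finsupp.sum]

end Generator

section Linear

variable {k : Type v} [CommRing k] {A : Type u} [Ring A] [Algebra k A]

/-- The functor `Hom(U, -)` with values in modules over the endomorphism ring of `U`. -/
def homFunctor (U : ModuleCat.{u} A) : ModuleCat.{u} A ⥤ ModuleCat.{u} (EndOp A U) where
  obj Y := ModuleCat.of _ (U →ₗ[A] Y)
  map f := ModuleCat.ofHom (homMap U f.hom)

instance (U : ModuleCat.{u} A) : (homFunctor U).Linear k where
  map_smul {Y Z} f r := by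
    ext s
    refine LinearMap.ext fun u => ?_
    exact (map_smul (f.hom ∘ₗ s) (algebraMap k A r) u).symm

/-- Morita's theorem: an algebra is Morita equivalent to the endomorphism algebra of a
progenerator. -/
lemma isMoritaEquivalent_endOp (U : ModuleCat.{u} A) [Module.Finite A U] [Module.Projective A U]
    (h : IsInAdd A U A) : IsMoritaEquivalent k A (EndOp A U) := by
  have : (homFunctor U).Full := ⟨fun {M N} φ => by
    obtain ⟨ψ, hψ⟩ := exists_homMap_eq_of_generator h φ.hom
    exact ⟨ModuleCat.ofHom ψ, ModuleCat.hom_ext hψ⟩⟩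
  have : (homFunctor U).Faithful := ⟨fun {M N f g} hfg => by
    exact ModuleCat.hom_ext ((separates_of_isInAdd h).homMap_injective
      (congrArg ModuleCat.Hom.hom hfg))⟩
  have : (homFunctor U).EssSurj := ⟨fun N => by
    obtain ⟨M, ⟨e⟩⟩ := exists_linearEquiv_hom h N
    exact ⟨M, ⟨e.toModuleIso⟩⟩⟩
  have : (homFunctor U).IsEquivalence := { }
  exact ⟨⟨⟨(homFunctor U).asEquivalence, inferInstanceAs ((homFunctor U).Linear k)⟩⟩⟩

/-- The endomorphism rings of `Y` and of `Hom(U, Y)` agree for `Y ∈ add U`. -/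
lemma nonempty_algEquiv_of_isInAdd (U Y : ModuleCat.{u} A) (h : IsInAdd A U Y) :
    Nonempty (EndOp A Y ≃ₐ[k] EndOp (EndOp A U) ((homFunctor U).obj Y)) := by
  let f : EndOp A Y →ₐ[k] EndOp (EndOp A U) ((homFunctor U).obj Y) :=
    { toFun := fun b => MulOpposite.op (homMap U b.unop)
      map_one' := rfl
      map_mul' := fun _ _ => rfl
      map_zero' := by
        refine congrArg MulOpposite.op (LinearMap.ext fun s => LinearMap.zero_comp s)
      map_add' := fun b c => by
        refine congrArg MulOpposite.op (LinearMap.ext fun s => LinearMap.add_comp s c.unop b.unop)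
      commutes' := fun r => by
        refine congrArg MulOpposite.op (LinearMap.ext fun s => LinearMap.ext fun u => ?_)
        exact (map_smul s (algebraMap k A r) u).symm }
  refine ⟨AlgEquiv.ofBijective f ⟨fun b c hbc => ?_, fun φ => ?_⟩⟩
  · have h1 : homMap U b.unop = homMap U c.unop := MulOpposite.op_injective hbc
    exact MulOpposite.unop_injective (h.hom_ext fun s => LinearMap.congr_fun h1 s)
  · obtain ⟨ψ, hψ⟩ := h.exists_homMap_eq φ.unop
    exact ⟨MulOpposite.op ψ, MulOpposite.unop_injective hψ⟩

end Linear

/-! ### Equivalences of additive closures -/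

section AddCategory

variable {A : Type u} [Ring A]

lemma IsInAdd.prod {U M N : Type u} [AddCommGroup U] [Module A U] [AddCommGroup M] [Module A M]
    [AddCommGroup N] [Module A N] (hM : IsInAdd A U M) (hN : IsInAdd A U N) :
    IsInAdd A U (M × N) := by
  obtain ⟨m, t, s, hst⟩ := hM.exists_sum
  obtain ⟨n, t', s', hst'⟩ := hN.exists_sum
  refine .of_sum (ι := Fin m ⊕ Fin n)
    (Sum.elim (fun i => t i ∘ₗ LinearMap.fst A M N) fun i => t' i ∘ₗ LinearMap.snd A M N)
    (Sum.elim (fun i => LinearMap.inl A M N ∘ₗ s i) fun i => LinearMap.inr A M N ∘ₗ s' i) ?_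
  have h1 := fun x => LinearMap.congr_fun hst x
  have h2 := fun x => LinearMap.congr_fun hst' x
  simp only [LinearMap.sum_apply, LinearMap.comp_apply, LinearMap.id_apply] at h1 h2
  refine LinearMap.ext fun x => ?_
  refine Prod.ext ?_ ?_ <;> simp [Fintype.sum_sum_type, Prod.fst_sum, Prod.snd_sum, h1, h2]

instance (U : ModuleCat.{u} A) : Limits.HasBinaryBiproducts (addClosure U).FullSubcategory where
  has_binary_biproduct X Y := by
    let Z : (addClosure U).FullSubcategory := ⟨ModuleCat.of A (X.obj × Y.obj),
      (addClosure_iff _ _).2 (((addClosure_iff _ _).1 X.property).prod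
        ((addClosure_iff _ _).1 Y.property))⟩
    let b : Limits.BinaryBicone X Y :=
      { pt := Z
        fst := ObjectProperty.homMk (ModuleCat.ofHom (LinearMap.fst A X.obj Y.obj))
        snd := ObjectProperty.homMk (ModuleCat.ofHom (LinearMap.snd A X.obj Y.obj))
        inl := ObjectProperty.homMk (ModuleCat.ofHom (LinearMap.inl A X.obj Y.obj))
        inr := ObjectProperty.homMk (ModuleCat.ofHom (LinearMap.inr A X.obj Y.obj))
        inl_fst := by
          refine ObjectProperty.hom_ext _ (ModuleCat.hom_ext (LinearMap.ext fun x => ?_)); rfl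
        inl_snd := by
          refine ObjectProperty.hom_ext _ (ModuleCat.hom_ext (LinearMap.ext fun x => ?_)); rfl
        inr_fst := by
          refine ObjectProperty.hom_ext _ (ModuleCat.hom_ext (LinearMap.ext fun x => ?_)); rfl
        inr_snd := by
          refine ObjectProperty.hom_ext _ (ModuleCat.hom_ext (LinearMap.ext fun x => ?_)); rfl }
    refine Limits.hasBinaryBiproduct_of_total b ?_
    refine ObjectProperty.hom_ext _ (ModuleCat.hom_ext (LinearMap.ext fun x => ?_))
    change ((x.1, 0) + (0, x.2) : X.obj × Y.obj) = x
    simp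

instance (U : ModuleCat.{u} A) : (addClosure U).IsClosedUnderIsomorphisms where
  of_iso e h := (addClosure_iff _ _).2
    (((addClosure_iff _ _).1 h).of_linearEquiv e.toLinearEquiv)

/-- An equivalence preserves biproducts, so its additivity need not be assumed. -/
lemma additive_of_equivalence {B : Type u} [Ring B] {U : ModuleCat.{u} A} {V : ModuleCat.{u} B}
    (e : (addClosure U).FullSubcategory ≌ (addClosure V).FullSubcategory) : e.functor.Additive :=
  Functor.additive_of_preserves_binary_products _

lemma isInAdd_iff_exists_sum_hom (U N : ModuleCat.{u} A) : IsInAdd A U N ↔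
    ∃ (n : ℕ) (t : Fin n → (N ⟶ U)) (s : Fin n → (U ⟶ N)), ∑ i, t i ≫ s i = 𝟙 N := by
  constructor
  · intro h
    obtain ⟨n, t, s, h⟩ := h.exists_sum
    refine ⟨n, fun i => ModuleCat.ofHom (t i), fun i => ModuleCat.ofHom (s i), ?_⟩
    ext1
    rw [ModuleCat.hom_sum]
    exact h
  · rintro ⟨n, t, s, h⟩
    refine .of_sum (fun i => (t i).hom) (fun i => (s i).hom) ?_
    have := congrArg ModuleCat.Hom.hom h
    rwa [ModuleCat.hom_sum] at this

/-- The object `U` of `add U`. -/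
def addGenerator (U : ModuleCat.{u} A) : (addClosure U).FullSubcategory :=
  ⟨U, (addClosure_iff _ _).2 isInAdd_self⟩

/-- Under an equivalence `add U ≌ add V`, the module `V` lies in `add` of the image of `U`. -/
lemma isInAdd_map_addGenerator {B : Type u} [Ring B] {U : ModuleCat.{u} A} {V : ModuleCat.{u} B}
    (e : (addClosure U).FullSubcategory ≌ (addClosure V).FullSubcategory) :
    IsInAdd B (e.functor.obj (addGenerator U)).obj V := by
  have := additive_of_equivalence e
  let W := e.inverse.obj (addGenerator V)
  obtain ⟨n, t, s, h⟩ := (isInAdd_iff_exists_sum_hom U W.obj).1 ((addClosure_iff _ _).1 W.property)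
  let t' : Fin n → (W ⟶ addGenerator U) := fun i => ObjectProperty.homMk (t i)
  let s' : Fin n → (addGenerator U ⟶ W) := fun i => ObjectProperty.homMk (s i)
  have h' : ∑ i, t' i ≫ s' i = 𝟙 W := by
    apply (addClosure U).ι.map_injective
    rw [Functor.map_sum]
    exact h
  have h1 : IsInAdd B (e.functor.obj (addGenerator U)).obj (e.functor.obj W).obj := by
    refine (isInAdd_iff_exists_sum_hom _ _).2 ⟨n, fun i => (e.functor.map (t' i)).hom,
      fun i => (e.functor.map (s' i)).hom, ?_⟩
    have h2 := congrArg (fun f => (addClosure V).ι.map (e.functor.map f)) h'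
    simp only [Functor.map_sum, Functor.map_comp] at h2
    exact h2.trans ((addClosure V).ι.congr_map (e.functor.map_id W))
  exact h1.of_linearEquiv
    ((addClosure V).ι.mapIso (e.counitIso.app (addGenerator V))).toLinearEquiv

variable {k : Type v} [CommRing k] [Algebra k A] {B : Type u} [Ring B] [Algebra k B]

/-- An equivalence identifies the endomorphism algebras of `U` and of its image. -/
lemma nonempty_algEquiv_of_equivalence {U : ModuleCat.{u} A} {V : ModuleCat.{u} B}
    (e : (addClosure U).FullSubcategory ≌ (addClosure V).FullSubcategory) [e.functor.Linear k] :
    Nonempty (EndOp A U ≃ₐ[k] EndOp B (e.functor.obj (addGenerator U)).obj) := by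
  have := additive_of_equivalence e
  let G := addGenerator U
  let φ : EndOp A U → EndOp B (e.functor.obj G).obj := fun b =>
    MulOpposite.op (e.functor.map (ObjectProperty.homMk (ModuleCat.ofHom b.unop) : G ⟶ G)).hom.hom
  have hadd : ∀ b c, φ (b + c) = φ b + φ c := fun b c => by
    have : (ObjectProperty.homMk (ModuleCat.ofHom (b + c).unop) : G ⟶ G) =
      ObjectProperty.homMk (ModuleCat.ofHom b.unop) +
        ObjectProperty.homMk (ModuleCat.ofHom c.unop) := rfl
    change MulOpposite.op _ = _
    rw [this, e.functor.map_add]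
    rfl
  let f : EndOp A U →ₐ[k] EndOp B (e.functor.obj G).obj :=
    { toFun := φ
      map_one' := by
        have : (ObjectProperty.homMk (ModuleCat.ofHom (1 : EndOp A U).unop) : G ⟶ G) = 𝟙 G := rfl
        change MulOpposite.op _ = _
        rw [this, e.functor.map_id]
        rfl
      map_mul' := fun b c => by
        have : (ObjectProperty.homMk (ModuleCat.ofHom (b * c).unop) : G ⟶ G) =
          (ObjectProperty.homMk (ModuleCat.ofHom b.unop) : G ⟶ G) ≫
            (ObjectProperty.homMk (ModuleCat.ofHom c.unop) : G ⟶ G) := rfl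
        change MulOpposite.op _ = _
        rw [this, e.functor.map_comp]
        rfl
      map_zero' := by
        have := hadd 0 0
        rwa [add_zero, left_eq_add] at this
      map_add' := hadd
      commutes' := fun r => by
        have : (ObjectProperty.homMk (ModuleCat.ofHom (algebraMap k (EndOp A U) r).unop) : G ⟶ G) =
          r • 𝟙 G := rfl
        change MulOpposite.op _ = _
        rw [this, e.functor.map_smul, e.functor.map_id]
        rfl }
  refine ⟨AlgEquiv.ofBijective f ⟨fun b c hbc => ?_, fun b => ?_⟩⟩
  · have h1 := e.functor.map_injective (ObjectProperty.hom_ext _ (ModuleCat.hom_ext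
      (MulOpposite.op_injective hbc)))
    exact MulOpposite.unop_injective (congrArg (fun g => g.hom.hom) h1)
  · obtain ⟨g, hg⟩ := e.functor.map_surjective
      (ObjectProperty.homMk (ModuleCat.ofHom b.unop) : e.functor.obj G ⟶ e.functor.obj G)
    refine ⟨MulOpposite.op g.hom.hom, MulOpposite.unop_injective ?_⟩
    exact congrArg (fun g => g.hom.hom) hg

/-- Equivalent additive closures have Morita equivalent endomorphism algebras: if `Z` is the image
of `U`, then `add Z = add V`, so `Hom(V, Z)` is a progenerator over `EndOp B V` whose endomorphism
algebra is that of `U`. -/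
lemma isMoritaEquivalent_of_equivalence {U : ModuleCat.{u} A} {V : ModuleCat.{u} B}
    [Module.Finite B V]
    (e : (addClosure U).FullSubcategory ≌ (addClosure V).FullSubcategory) [e.functor.Linear k] :
    IsMoritaEquivalent k (EndOp A U) (EndOp B V) := by
  let Z := (e.functor.obj (addGenerator U)).obj
  have hZ : IsInAdd B V Z := (addClosure_iff _ _).1 (e.functor.obj (addGenerator U)).property
  have hV : IsInAdd B Z V := isInAdd_map_addGenerator e
  have hT : IsInAdd (EndOp B V) (EndOp B V) ((homFunctor V).obj Z) := hZ.hom_self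
  have hT' : IsInAdd (EndOp B V) ((homFunctor V).obj Z) (EndOp B V) :=
    hV.hom.of_linearEquiv (homSelfEquiv B V)
  have := hT.finite
  have := hT.projective
  obtain ⟨f⟩ := nonempty_algEquiv_of_equivalence (k := k) e
  obtain ⟨g⟩ := nonempty_algEquiv_of_isInAdd (k := k) V Z hZ
  exact (IsMoritaEquivalent.of_algEquiv k (f.trans g)).trans k
    (isMoritaEquivalent_endOp ((homFunctor V).obj Z) hT').symm

end AddCategory

/-! ### Morita equivalences and finitely generated projective modules -/

section Projectivization

variable {A : Type u} [Ring A]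

lemma IsInAdd.map {B : Type u} [Ring B] {U N : ModuleCat.{u} A} (h : IsInAdd A U N)
    (F : ModuleCat.{u} A ⥤ ModuleCat.{u} B) [F.Additive] : IsInAdd B (F.obj U) (F.obj N) := by
  obtain ⟨n, t, s, h⟩ := (isInAdd_iff_exists_sum_hom U N).1 h
  refine (isInAdd_iff_exists_sum_hom _ _).2 ⟨n, fun i => F.map (t i), fun i => F.map (s i), ?_⟩
  simp only [← Functor.map_comp, ← Functor.map_sum, h]
  exact F.map_id N

/-- The preimage of the regular module under an equivalence of module categories is a generator. -/
lemma isInAdd_inverse_obj {B : Type u} [Ring B] (e : ModuleCat.{u} A ≌ ModuleCat.{u} B)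
    [e.functor.Additive] : IsInAdd A (e.inverse.obj (ModuleCat.of B B)) A := by
  refine isInAdd_of_separates fun I K _ _ g hg => ?_
  let g' : ModuleCat.of A K ⟶ I := ModuleCat.ofHom g
  have h1 : e.functor.map g' = 0 := by
    refine ModuleCat.hom_ext (LinearMap.ext fun y => ?_)
    let s : e.inverse.obj (ModuleCat.of B B) ⟶ ModuleCat.of A K :=
      (e.symm.toAdjunction.homEquiv _ _).symm (ModuleCat.ofHom (LinearMap.toSpanSingleton B _ y))
    have hs : s ≫ g' = 0 := ModuleCat.hom_ext (hg s.hom)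
    have h2 : ModuleCat.ofHom (LinearMap.toSpanSingleton B _ y) ≫ e.functor.map g' = 0 := by
      have h3 := e.symm.toAdjunction.homEquiv_naturality_right_symm
        (ModuleCat.ofHom (LinearMap.toSpanSingleton B _ y)) g'
      have h4 := (h3.trans hs).trans (e.symm.toAdjunction.homEquiv_naturality_right_symm
        (0 : ModuleCat.of B B ⟶ e.functor.obj (ModuleCat.of A K)) (0 : _ ⟶ I) |>.trans
          Limits.comp_zero).symm
      have h5 := (e.symm.toAdjunction.homEquiv _ _).symm.injective h4
      exact h5.trans Limits.zero_comp
    have h6 := LinearMap.congr_fun (congrArg ModuleCat.Hom.hom h2) (1 : B)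
    simpa using h6
  have h7 : g' = 0 := e.functor.map_injective (h1.trans (e.functor.map_zero _ _).symm)
  exact congrArg ModuleCat.Hom.hom h7

/-- An equivalence of module categories preserves finitely generated projective modules. -/
lemma addClosure_functor_obj {B : Type u} [Ring B] (e : ModuleCat.{u} A ≌ ModuleCat.{u} B)
    [e.functor.Additive] {N : ModuleCat.{u} A} (h : addClosure (ModuleCat.of A A) N) :
    addClosure (ModuleCat.of B B) (e.functor.obj N) := by
  have h1 : IsInAdd B (e.functor.obj (ModuleCat.of A A)) (e.functor.obj N) :=
    ((addClosure_iff _ _).1 h).map e.functor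
  have h2 : IsInAdd B (e.functor.obj (e.inverse.obj (ModuleCat.of B B)))
      (e.functor.obj (ModuleCat.of A A)) :=
    IsInAdd.map (N := ModuleCat.of A A) (isInAdd_inverse_obj e) e.functor
  have h3 : IsInAdd B B (e.functor.obj (e.inverse.obj (ModuleCat.of B B))) :=
    isInAdd_self.of_linearEquiv (e.counitIso.app (ModuleCat.of B B)).symm.toLinearEquiv
  exact (addClosure_iff _ _).2 (h1.trans (h2.trans h3))

lemma inverseImage_addClosure {B : Type u} [Ring B] (e : ModuleCat.{u} A ≌ ModuleCat.{u} B)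
    [e.functor.Additive] :
    (addClosure (ModuleCat.of B B)).inverseImage e.functor = addClosure (ModuleCat.of A A) := by
  ext N
  refine ⟨fun h => ?_, addClosure_functor_obj e⟩
  have : e.symm.functor.Additive := inferInstanceAs e.inverse.Additive
  exact (addClosure (ModuleCat.of A A)).prop_of_iso (e.unitIso.app N).symm
    (addClosure_functor_obj e.symm h)

variable {k : Type v} [CommRing k] [Algebra k A]

/-- The functor `Hom(U, -)` from `add U` to finitely generated projective modules. -/
def addHomFunctor (U : ModuleCat.{u} A) : (addClosure U).FullSubcategory ⥤
    (addClosure (ModuleCat.of (EndOp A U) (EndOp A U))).FullSubcategory :=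
  ObjectProperty.lift _ ((addClosure U).ι ⋙ homFunctor U) fun Y =>
    (addClosure_iff _ _).2 ((addClosure_iff _ _).1 Y.property).hom_self

instance (U : ModuleCat.{u} A) : (addHomFunctor U).Full where
  map_surjective {Y Z} φ := by
    obtain ⟨ψ, hψ⟩ := ((addClosure_iff _ _).1 Y.property).exists_homMap_eq φ.hom.hom
    exact ⟨ObjectProperty.homMk (ModuleCat.ofHom ψ),
      ObjectProperty.hom_ext _ (ModuleCat.hom_ext hψ)⟩

instance (U : ModuleCat.{u} A) : (addHomFunctor U).Faithful where
  map_injective {Y Z f g} hfg := by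
    refine ObjectProperty.hom_ext _ (ModuleCat.hom_ext ?_)
    refine ((addClosure_iff _ _).1 Y.property).hom_ext fun s => ?_
    exact LinearMap.congr_fun (congrArg (fun l => l.hom.hom) hfg) s

/-- Idempotents split in `add U`, so each finitely generated projective module, being a direct
summand of some `Hom(U, Uⁿ)`, comes from a direct summand of `Uⁿ`. -/
instance (U : ModuleCat.{u} A) : (addHomFunctor U).EssSurj where
  mem_essImage N := by
    have hN : IsInAdd (EndOp A U) (U →ₗ[A] U) N.obj :=
      ((addClosure_iff _ _).1 N.property).trans
        (isInAdd_self.of_linearEquiv (homSelfEquiv A U))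
    obtain ⟨n, t, s, hst⟩ := hN.exists_sum
    let t' : N.obj →ₗ[EndOp A U] (U →ₗ[A] (Fin n → U)) :=
      ∑ i, homMap U (LinearMap.single A (fun _ => U) i) ∘ₗ t i
    let s' : (U →ₗ[A] (Fin n → U)) →ₗ[EndOp A U] N.obj := ∑ i, s i ∘ₗ homMap U (LinearMap.proj i)
    have hst' : s' ∘ₗ t' = LinearMap.id := by
      rw [← hst]
      have hp : ∀ x i, LinearMap.proj i ∘ₗ t' x = t i x := fun x i => by
        ext u
        simp [t', LinearMap.sum_apply, Pi.single_apply]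
      ext x
      simp only [s', LinearMap.comp_apply, LinearMap.sum_apply, homMap_apply, hp]
    have hU : IsInAdd A U (Fin n → U) := .pi (LinearEquiv.refl A _) fun _ => isInAdd_self
    obtain ⟨π, hπ⟩ := hU.exists_homMap_eq (t' ∘ₗ s')
    have hππ : π ∘ₗ π = π := hU.hom_ext fun f => by
      have : homMap U π ∘ₗ homMap U π = homMap U π := by
        rw [hπ, LinearMap.comp_assoc, ← LinearMap.comp_assoc s', hst', LinearMap.id_comp]
      exact LinearMap.congr_fun this f
    let W := LinearMap.range π
    have hri : π.rangeRestrict ∘ₗ W.subtype = LinearMap.id := by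
      refine LinearMap.ext ?_
      rintro ⟨_, x, rfl⟩
      exact Subtype.ext (LinearMap.congr_fun hππ x)
    have hir : W.subtype ∘ₗ π.rangeRestrict = π := rfl
    let Z : (addClosure U).FullSubcategory := ⟨ModuleCat.of A W,
      (addClosure_iff _ _).2 (hU.retract W.subtype π.rangeRestrict hri)⟩
    let f : (U →ₗ[A] W) →ₗ[EndOp A U] N.obj := s' ∘ₗ homMap U W.subtype
    let g : N.obj →ₗ[EndOp A U] (U →ₗ[A] W) := homMap U π.rangeRestrict ∘ₗ t'
    have hfg : f ∘ₗ g = LinearMap.id := by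
      have : f ∘ₗ g = s' ∘ₗ homMap U π ∘ₗ t' := rfl
      rw [this, hπ, LinearMap.comp_assoc, hst', LinearMap.comp_id, hst']
    have hgf : g ∘ₗ f = LinearMap.id := by
      have h1 : g ∘ₗ f = homMap U π.rangeRestrict ∘ₗ (t' ∘ₗ s') ∘ₗ homMap U W.subtype := rfl
      have h2 : homMap U π.rangeRestrict ∘ₗ homMap U π ∘ₗ homMap U W.subtype =
        homMap U ((π.rangeRestrict ∘ₗ W.subtype) ∘ₗ π.rangeRestrict ∘ₗ W.subtype) := rfl
      rw [h1, ← hπ, h2, hri]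
      rfl
    let e : (U →ₗ[A] W) ≃ₗ[EndOp A U] N.obj := LinearEquiv.ofLinearMap f g hfg hgf
    exact ⟨Z, ⟨ObjectProperty.isoMk _ e.toModuleIso⟩⟩

instance (U : ModuleCat.{u} A) : (addHomFunctor U).IsEquivalence where

instance (U : ModuleCat.{u} A) : (addHomFunctor U).Linear k where
  map_smul f r := ObjectProperty.hom_ext _ ((homFunctor U).map_smul r f.hom)

variable {B : Type u} [Ring B] [Algebra k B]

/-- Modules with Morita equivalent endomorphism algebras have equivalent additive closures, because
`add U` is equivalent to the category of finitely generated projective modules over `EndOp A U`. -/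
lemma exists_equivalence_of_isMoritaEquivalent (U : ModuleCat.{u} A) (V : ModuleCat.{u} B)
    (h : IsMoritaEquivalent k (EndOp A U) (EndOp B V)) :
    ∃ e : (addClosure U).FullSubcategory ≌ (addClosure V).FullSubcategory,
      e.functor.Linear k := by
  obtain ⟨⟨e, hlin⟩⟩ := h
  have : e.functor.Additive := e.functor.additive_of_preserves_binary_products
  let e₁ := (addHomFunctor U).asEquivalence
  let e₂ := e.congrFullSubcategory (inverseImage_addClosure e)
  let e₃ := (addHomFunctor V).asEquivalence
  have h₁ : e₁.functor.Linear k := inferInstanceAs ((addHomFunctor U).Linear k)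
  have h₂ : e₂.functor.Linear k :=
    ⟨fun {Y Z} f r => ObjectProperty.hom_ext _ (e.functor.map_smul r f.hom)⟩
  have h₃ : e₃.functor.Linear k := inferInstanceAs ((addHomFunctor V).Linear k)
  have h₃' : e₃.symm.functor.Linear k := e₃.inverseLinear k
  have h₂₃ : (e₂.trans e₃.symm).functor.Linear k :=
    e₂.functor.instLinearComp e₃.symm.functor
  exact ⟨e₁.trans (e₂.trans e₃.symm), e₁.functor.instLinearComp (e₂.trans e₃.symm).functor⟩

end Projectivization

/-! ### The correspondence -/

section Correspondence

variable {k : Type v} [CommRing k]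

/-- The endomorphism algebra of the cluster tilting module `Hom(P, Γ)` is `Γ`. -/
lemma nonempty_algEquiv_of_isDetecting {Γ : Type u} [Ring Γ] [Algebra k Γ] {d : ℕ} (hd : 1 ≤ d)
    (P Q : ModuleCat.{u} Γ) (h : IsDetecting d Γ P Q) :
    Nonempty (Γ ≃ₐ[k] EndOp (EndOp Γ P) ((homFunctor P).obj (ModuleCat.of Γ Γ))) := by
  let f : Γ →ₐ[k] EndOp (EndOp Γ P) ((homFunctor P).obj (ModuleCat.of Γ Γ)) :=
    { toFun := fun γ => MulOpposite.op (homMap P (LinearMap.toSpanSingleton Γ Γ γ))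
      map_one' := by
        refine congrArg MulOpposite.op (LinearMap.ext fun s => LinearMap.ext fun p => ?_)
        exact mul_one (s p)
      map_mul' := fun a b => by
        refine congrArg MulOpposite.op (LinearMap.ext fun s => LinearMap.ext fun p => ?_)
        exact (mul_assoc (s p) a b).symm
      map_zero' := by
        refine congrArg MulOpposite.op (LinearMap.ext fun s => LinearMap.ext fun p => ?_)
        exact mul_zero (s p)
      map_add' := fun a b => by
        refine congrArg MulOpposite.op (LinearMap.ext fun s => LinearMap.ext fun p => ?_)
        exact mul_add (s p) a b
      commutes' := fun r => by
        refine congrArg MulOpposite.op (LinearMap.ext fun s => LinearMap.ext fun p => ?_)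
        exact (Algebra.commutes r (s p)).symm.trans (map_smul s (algebraMap k Γ r) p).symm }
  exact ⟨AlgEquiv.ofBijective f (h.mulRight_bijective hd)⟩

/-- The Auslander correspondence for a class of Artin `k`-algebras which is closed under taking
endomorphism algebras of finitely generated modules. -/
theorem exists_correspondence {A : ObjectProperty (AlgCat.{u} k)}
    (hA : ∀ Λ, A Λ → IsArtinAlgebra Λ)
    (hEnd : ∀ (Λ : AlgCat.{u} k) (M : ModuleCat.{u} Λ), A Λ → Module.Finite Λ M →
      A (AlgCat.of k (Module.End Λ M)ᵐᵒᵖ)) {d : ℕ} (hd : 1 ≤ d) :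
    ∃ (h : ∀ X : ClusterTiltingModule A d, A X.endAlg ∧ IsAuslander X.endAlg d)
      (Φ : Quotient (clusterTiltingSetoid A d) ≃ Quotient (moritaSetoid A d)),
      ∀ X, Φ (Quotient.mk _ X) = Quotient.mk _ ⟨X.endAlg, (h X).1, (h X).2⟩ := by
  have hX : ∀ X : ClusterTiltingModule A d, IsClusterTiltingModule d X.alg X.module := fun X =>
    (isClusterTilting_iff (hA _ X.mem) _).1 X.isClusterTilting
  have h : ∀ X : ClusterTiltingModule A d, A X.endAlg ∧ IsAuslander X.endAlg d := fun X =>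
    ⟨hEnd _ _ X.mem (hX X).finite, (hX X).isAuslander_endOp hd (hA _ X.mem)⟩
  let f : Quotient (clusterTiltingSetoid A d) → Quotient (moritaSetoid A d) :=
    Quotient.map (fun X => ⟨X.endAlg, (h X).1, (h X).2⟩) fun X Y ⟨e, he⟩ => by
      have := (hX Y).finite
      exact isMoritaEquivalent_of_equivalence (k := k) e
  have hf : Function.Bijective f := by
    constructor
    · rintro ⟨X⟩ ⟨Y⟩ hXY
      exact Quotient.sound (exists_equivalence_of_isMoritaEquivalent X.module Y.module
        (Quotient.exact hXY))
    · rintro ⟨Γ⟩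
      obtain ⟨P, Q, hPQ⟩ := exists_isDetecting (hA _ Γ.mem) Γ.isAuslander
      have := hPQ.finite_left
      let Λ : AlgCat.{u} k := AlgCat.of k (EndOp Γ.alg P)
      have hΛ : A Λ := hEnd _ _ Γ.mem inferInstance
      let X : ClusterTiltingModule A d := ⟨Λ, hΛ, (homFunctor P).obj (ModuleCat.of Γ.alg Γ.alg),
        (isClusterTilting_iff (hA _ hΛ) _).2 (hPQ.isClusterTiltingModule hd)⟩
      obtain ⟨e⟩ := nonempty_algEquiv_of_isDetecting (k := k) hd P Q hPQ
      refine ⟨Quotient.mk _ X, Quotient.sound ?_⟩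
      exact (IsMoritaEquivalent.of_algEquiv k e).symm
  exact ⟨h, Equiv.ofBijective f hf, fun X => rfl⟩

end Correspondence

end AuslanderCorr

theorem mainTheorem1 (d : ℕ) (hd : 1 ≤ d) :
    -- all Artin algebras, equivalences of additive categories
    (∃ (h : ∀ X : AuslanderCorr.ClusterTiltingModule AuslanderCorr.artinAlgebras.{u} d,
          AuslanderCorr.artinAlgebras X.endAlg ∧ AuslanderCorr.IsAuslander X.endAlg d)
        (Φ : Quotient (AuslanderCorr.clusterTiltingSetoid AuslanderCorr.artinAlgebras.{u} d) ≃
          Quotient (AuslanderCorr.moritaSetoid AuslanderCorr.artinAlgebras.{u} d)),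
        ∀ X, Φ (Quotient.mk _ X) = Quotient.mk _ ⟨X.endAlg, (h X).1, (h X).2⟩) ∧
    -- Artin algebras over a fixed base ring, linear equivalences
    (∀ (R : Type v) [CommRing R] [IsArtinianRing R],
      ∃ (h : ∀ X : AuslanderCorr.ClusterTiltingModule (AuslanderCorr.finiteAlgebras.{v, u} R) d,
          AuslanderCorr.finiteAlgebras R X.endAlg ∧ AuslanderCorr.IsAuslander X.endAlg d)
        (Φ : Quotient
            (AuslanderCorr.clusterTiltingSetoid (AuslanderCorr.finiteAlgebras.{v, u} R) d) ≃
          Quotient (AuslanderCorr.moritaSetoid (AuslanderCorr.finiteAlgebras.{v, u} R) d)),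
        ∀ X, Φ (Quotient.mk _ X) = Quotient.mk _ ⟨X.endAlg, (h X).1, (h X).2⟩) := by
  refine ⟨AuslanderCorr.exists_correspondence (fun _ h => h) (fun Λ M h _ => ?_) hd,
    fun R _ _ => AuslanderCorr.exists_correspondence (fun Λ h => ?_) (fun Λ M h _ => ?_) hd⟩
  · exact AuslanderCorr.IsArtinAlgebra.endOp h M
  · have : Module.Finite R Λ := h
    exact AuslanderCorr.isArtinAlgebra_of_finite R
  · have : Module.Finite R Λ := h
    have : Module.Finite R (M →ₗ[Λ] M) := AuslanderCorr.finite_hom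
    exact Module.Finite.equiv (MulOpposite.opLinearEquiv R)
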